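/- **Setting.** Let $L$ be an arbitrary first-order language (predicate symbols, function symbols, constants). Formulas are built from atomic formulas (no equality) and the logical constants $\top,\bot$ by $\neg,\wedge,\vee,\supset,\forall,\exists$; there are infinitely many free variables. A sequent $\Gamma\to\Delta$ is a pair of finite multisets of formulas. LK is the cut-free classical sequent calculus with initial sequents $A,\Gamma\to\Delta,A$; $\ \Gamma\to\Delta,\top$; $\ \bot,\Gamma\to\Delta$; the rules of weakening and contraction on both sides; and the left and right rules for $\neg,\wedge,\vee,\supset,\forall,\exists$, where two-premise rules combine the side formulas of the premises, $\wedge$:left, $\vee$:right and $\supset$:right take both auxiliary formulas in their single premise, and $\forall$:right and $\exists$:left carry the usual eigenvariable condition. **Operators.** A structured set is a pair $\langle S^1\mid S^2\rangle$ of finite multisets of sets of points. An $l$-ary operator is a pseudomap (relation) from $l$-tuples of structured sets to structured sets: it takes a fixed number of arguments (at least one) in each of $S_1,\dots,S_l$, in fixed components, deletes them, collects all remaining sets of points in their components, and adds one set $s_0$, the value, to one component; each argument is embedded into $s_0$ by a relation defined at every point of the argument. Apart from a possible applicability requirement on the remaining sets, it acts in the same manner on all structured sets that contain the arguments. Composition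 feeds the value of one operator to another one as an argument; an operator is constructible from $\mathcal O$ if it is in $\mathcal O$ or is obtained from operators in $\mathcal O$ by composition. An $l$-ary and a unary operator, acting on $S_1,\dots,S_l$ and on $S_r$, form a regular pair if the $l$-ary operator takes exactly one argument $s_h$ in each $S_h$, the arguments of the unary operator are $s_1,\dots,s_l$, each in the opposite component, and the values and the embeddings of the $s_h$ into them are the same, the values lying in opposite components. $\mathcal O$ is closed under regularity if, for every $l$-ary operator in $\mathcal O$ that acts on some $S_1,\dots,S_l$, all $i_0,i_1,\dots,i_l\in\{1,2\}$, all $s_h$ in component $i_h$ of $S_h$, and every $S_r$ that contains $s_1,\dots,s_l$ (as separate occurrences), each $s_h$ in the component opposite to $i_h$, there is a regular pair constructible from $\mathcal O$ whose $l$-ary operator acts on $S_1,\dots,S_l$ with arguments $s_1,\dots,s_l$ and value in component $i_0$, and whose unary operator acts on $S_r$. **Interpretation.** A formula is the set of its occurrences of atomic formulas (so $\top$ and $\bot$ are empty sets of points) together with its tree structure; a sequent $\Gamma\to\Delta$ is the structured set $\langle\Gamma\mid\Delta\rangle$; every rule of LK other than weakening is the operator that takes the auxiliary formulas as arguments and the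 main formula as value, the embeddings being the logical links between atomic occurrences (for contraction, the two copies are embedded by the identity), and the eigenvariable condition being the applicability requirement. Let $\mathcal O_{LK}$ be the set of these operators. **Theorem.** 1. A sequent is provable in LK if and only if, as a structured set, it is obtained from initial sequents by finitely many applications of operators in $\mathcal O_{LK}$. 2. $\mathcal O_{LK}$ is closed under regularity. 3. (Craig interpolation.) For all formulas $A,B$: if $A\to B$ is provable in LK, then there is a formula $I$ in the common language of $A$ and $B$, i.e. every predicate symbol, function symbol, constant and free variable of $I$ occurs both in $A$ and in $B$, such that $A\to I$ and $I\to B$ are provable in LK. -/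

import Mathlib

universe u v w

/-! ## Structured sets and operators -/

namespace Interp

/-- The two components of a structured set (for sequents: antecedent and succedent). -/
inductive Side where
  | first
  | second
  deriving DecidableEq

/-- The opposite component. -/
def Side.opp : Side → Side
  | .first => .second
  | .second => .first

/-- A universe `P` of (structured) sets of points: `Pt s` is the type of points of `s`. -/
class HasPoints (P : Type w) where
  Pt : P → Type

/-- A structured set `⟨s₁ … s_k | s_{k+1} … s_n⟩`: each of the two components is a finite collection
of sets of points in which several copies of the same set may occur.  Structured sets are added
componentwise. -/
abbrev StructuredSet (P : Type w) : Type w := Side → Multiset P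

/-- The structured set whose only member is one copy of `s`, in component `i`. -/
def StructuredSet.single {P : Type w} (i : Side) (s : P) : StructuredSet P :=
  Pi.single i {s}

/-- A set of points `src` together with a pseudomap (a relation) from its points to those of `v`. -/
structure Link {P : Type w} [HasPoints P] (v : P) where
  src : P
  rel : HasPoints.Pt src → HasPoints.Pt v → Prop

/-- The pseudomap is an embedding when it is defined at every point of its source. -/
def Link.IsEmbedding {P : Type w} [HasPoints P] {v : P} (f : Link v) : Prop :=
  ∀ x, ∃ y, f.rel x y

/-- Composition of pseudomaps: `g` leads into `v`, and `f` leads from `v` into `z`. -/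
def Link.comp {P : Type w} [HasPoints P] {v z : P} (g : Link v) (f : Link z) (h : v = f.src) :
    Link z where
  src := g.src
  rel x y := ∃ m, g.rel x m ∧ f.rel (h ▸ m) y

/-- An operator on structured sets.  `Input` indexes the structured sets acted on (its cardinality
is the arity) and `Arg` indexes the arguments (its cardinality is the subarity); argument `a` is
taken in component `side a` of the structured set number `input a`, and at least one argument is
taken in each structured set.  The value lies in component `valueSide`.  The operator is a
pseudomap: it consists of a family `Inst` of instances, each of which prescribes the value, the
arguments and the embeddings of the arguments into the value.  An instance acts in the same manner
on all structured sets that contain its arguments, see `Operator.Acts`, subject to a requirement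
`Applicable` on the other sets of points (needed only for eigenvariables). -/
structure Operator (P : Type w) [HasPoints P] where
  Input : Type
  Arg : Type
  [fintypeInput : Fintype Input]
  [nonemptyInput : Nonempty Input]
  [fintypeArg : Fintype Arg]
  input : Arg → Input
  input_surjective : Function.Surjective input
  side : Arg → Side
  valueSide : Side
  Inst : Type w
  value : Inst → P
  arg : (p : Inst) → Arg → Link (value p)
  isEmbedding : ∀ p a, (arg p a).IsEmbedding
  Applicable : Inst → (Input → StructuredSet P) → Prop

attribute [instance] Operator.fintypeInput Operator.nonemptyInput Operator.fintypeArg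

section

variable {P : Type w} [HasPoints P]

open Classical in
/-- The instance `p` of the operator `o` maps the family `S` to the output `S₀`: each `S i` consists
of the arguments taken in it and of side sets `C i`, and `S₀` consists of all the side sets and of
the value. -/
def Operator.Acts (o : Operator P) (p : o.Inst) (S : o.Input → StructuredSet P)
    (S₀ : StructuredSet P) : Prop :=
  ∃ C : o.Input → StructuredSet P, o.Applicable p C ∧
    (∀ i, S i = C i +
      ∑ a ∈ Finset.univ.filter (fun a => o.input a = i),
        StructuredSet.single (o.side a) (o.arg p a).src) ∧
    S₀ = ∑ i, C i + StructuredSet.single o.valueSide (o.value p)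

open Classical in
/-- The composition of operators: first `Q` acts, and its output is then used as the structured
set number `R.input a₀` by `R`, in such a way that the value of `Q` becomes the argument `a₀` of
`R`.  The other arguments that `R` takes in the output of `Q` are side sets of `Q`; `route` says in
which of the structured sets acted on by `Q` they are found. -/
noncomputable def Operator.comp (R Q : Operator P) (a₀ : R.Arg)
    (_hside : Q.valueSide = R.side a₀) (route : R.Arg → Q.Input) : Operator P where
  Input := {i : R.Input // i ≠ R.input a₀} ⊕ Q.Input
  Arg := {a : R.Arg // a ≠ a₀} ⊕ Q.Arg
  input := Sum.elim
    (fun a => if h : R.input a = R.input a₀ then Sum.inr (route a) else Sum.inl ⟨R.input a, h⟩)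
    (fun b => Sum.inr (Q.input b))
  input_surjective := by
    rintro (⟨i, hi⟩ | j)
    · obtain ⟨a, rfl⟩ := R.input_surjective i
      refine ⟨Sum.inl ⟨a, fun h => hi (by rw [h])⟩, ?_⟩
      simp [hi]
    · obtain ⟨b, rfl⟩ := Q.input_surjective j
      exact ⟨Sum.inr b, rfl⟩
  side := Sum.elim (fun a => R.side a) Q.side
  valueSide := R.valueSide
  Inst := {x : R.Inst × Q.Inst // Q.value x.2 = (R.arg x.1 a₀).src}
  value x := R.value x.1.1
  arg x := Sum.rec (fun a => R.arg x.1.1 a) (fun b => (Q.arg x.1.2 b).comp (R.arg x.1.1 a₀) x.2)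
  isEmbedding := by
    rintro ⟨⟨p, q⟩, h⟩ (a | b)
    · exact R.isEmbedding p a
    · intro x
      obtain ⟨m, hm⟩ := Q.isEmbedding q b x
      obtain ⟨y, hy⟩ := R.isEmbedding p a₀ (h ▸ m)
      exact ⟨y, m, hm, hy⟩
  Applicable x C :=
    Q.Applicable x.1.2 (fun j => C (Sum.inr j) +
      ∑ a ∈ Finset.univ.filter
          (fun a => a ≠ a₀ ∧ R.input a = R.input a₀ ∧ route a = j),
        StructuredSet.single (R.side a) (R.arg x.1.1 a).src) ∧
    R.Applicable x.1.1 (fun i =>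
      if h : i = R.input a₀ then ∑ j, C (Sum.inr j) else C (Sum.inl ⟨i, h⟩))

/-- An operator is constructible from `O` if it belongs to `O` or is a composition of operators
in `O`. -/
inductive Constructible (O : Set (Operator P)) : Operator P → Prop
  | mem {o : Operator P} (h : o ∈ O) : Constructible O o
  | comp {R Q : Operator P} (a₀ : R.Arg) (hside : Q.valueSide = R.side a₀)
      (route : R.Arg → Q.Input) (hP : Constructible O R) (hQ : Constructible O Q) :
      Constructible O (R.comp Q a₀ hside route)

/-- The value of an instance, with all its arguments and their embeddings into the value. -/
def Operator.pattern (o : Operator P) (p : o.Inst) : Σ s : P, (o.Arg → Link s) :=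
  ⟨o.value p, o.arg p⟩

/-- The operators `k` and `r`, acting through the instances `x` and `y`, form a regular pair: `r` is
unary, `k` takes exactly one argument in each structured set, the arguments of `r` are those
of `k` but in the opposite components, the values are the same but lie in opposite components, and
the embeddings of the arguments into the value are the same. -/
def IsRegularPair (k r : Operator P) (x : k.Inst) (y : r.Inst) : Prop :=
  Fintype.card r.Input = 1 ∧
  Function.Bijective k.input ∧
  r.valueSide = k.valueSide.opp ∧
  ∃ e : k.Arg ≃ r.Arg,
    (∀ a, r.side (e a) = (k.side a).opp) ∧
    k.pattern x = ⟨r.value y, fun a => r.arg y (e a)⟩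

/-- A set of operators is closed under regularity: given an `l`-ary operator `o` of the set acting
on `S₁, …, S_l`, components `i₀, i₁, …, i_l`, sets of points `s_h` in component `i_h` of `S_h`, and a
structured set `Sr` that contains `s₁, …, s_l`, each in the component opposite to `i_h`, there is a
regular pair constructible from the set whose `l`-ary operator acts on `S₁, …, S_l` with arguments
`s_h` and a value in component `i₀`, and whose unary operator acts on `Sr`. -/
def ClosedUnderRegularity (O : Set (Operator P)) : Prop :=
  ∀ o ∈ O, ∀ S : o.Input → StructuredSet P, (∃ p S₀, o.Acts p S S₀) →
    ∀ (i₀ : Side) (i : o.Input → Side) (s : o.Input → P), (∀ h, s h ∈ S h (i h)) →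
      ∀ Sr : StructuredSet P, (∑ h, StructuredSet.single (i h).opp (s h)) ≤ Sr →
        ∃ (k r : Operator P) (x : k.Inst) (y : r.Inst) (e : k.Input ≃ o.Input),
          Constructible O k ∧ Constructible O r ∧ IsRegularPair k r x y ∧
          k.valueSide = i₀ ∧
          (∀ a, k.side a = i (e (k.input a)) ∧ (k.arg x a).src = s (e (k.input a))) ∧
          (∃ S₀, k.Acts x (fun h => S (e h)) S₀) ∧
          (∃ S₀, r.Acts y (fun _ => Sr) S₀)

/-- The structured sets obtained from those in `T` by finitely many applications of operators
in `O`. -/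
inductive Generated (O : Set (Operator P)) (T : Set (StructuredSet P)) : StructuredSet P → Prop
  | base {S : StructuredSet P} (h : S ∈ T) : Generated O T S
  | step {o : Operator P} (ho : o ∈ O) (p : o.Inst) {S : o.Input → StructuredSet P}
      {S₀ : StructuredSet P} (hS : ∀ i, Generated O T (S i)) (h : o.Acts p S S₀) :
      Generated O T S₀

/-- An operator that takes the single argument `arg p`, in component `s`, of a single structured
set. -/
def Operator.ofOne (s t : Side) (Inst : Type w) (value : Inst → P)
    (arg : (p : Inst) → Link (value p)) (h : ∀ p, (arg p).IsEmbedding)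
    (app : Inst → StructuredSet P → Prop) : Operator P where
  Input := Unit
  Arg := Unit
  input := id
  input_surjective := Function.surjective_id
  side _ := s
  valueSide := t
  Inst := Inst
  value := value
  arg p _ := arg p
  isEmbedding p _ := h p
  Applicable p C := app p (C ())

/-- An operator without applicability requirement that takes two arguments, in components `s₁` and
`s₂`, in a single structured set. -/
def Operator.ofTwo (s₁ s₂ t : Side) (Inst : Type w) (value : Inst → P)
    (arg₁ arg₂ : (p : Inst) → Link (value p)) (h₁ : ∀ p, (arg₁ p).IsEmbedding)
    (h₂ : ∀ p, (arg₂ p).IsEmbedding) : Operator P where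
  Input := Unit
  Arg := Bool
  input _ := ()
  input_surjective := fun _ => ⟨true, rfl⟩
  side b := bif b then s₂ else s₁
  valueSide := t
  Inst := Inst
  value := value
  arg p b := bif b then arg₂ p else arg₁ p
  isEmbedding p b := by cases b <;> simp [h₁, h₂]
  Applicable _ _ := True

/-- An operator without applicability requirement that takes one argument in each of two structured
sets, in components `s₁` and `s₂` respectively. -/
def Operator.ofPair (s₁ s₂ t : Side) (Inst : Type w) (value : Inst → P)
    (arg₁ arg₂ : (p : Inst) → Link (value p)) (h₁ : ∀ p, (arg₁ p).IsEmbedding)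
    (h₂ : ∀ p, (arg₂ p).IsEmbedding) : Operator P where
  Input := Bool
  Arg := Bool
  input := id
  input_surjective := Function.surjective_id
  side b := bif b then s₂ else s₁
  valueSide := t
  Inst := Inst
  value := value
  arg p b := bif b then arg₂ p else arg₁ p
  isEmbedding p b := by cases b <;> simp [h₁, h₂]
  Applicable _ _ := True

end

end Interp

/-! ## First-order formulas -/

namespace LK

open Interp

/-- Terms with free variables `a₀, a₁, …` and bound variables indexed by `Fin n`. -/
abbrev Tm (L : FirstOrder.Language.{u, v}) (n : ℕ) : Type u := L.Term (ℕ ⊕ Fin n)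

/-- First-order formulas without equality in which at most the bound variables indexed by `Fin n`
are not yet quantified; a quantifier binds the variable with the largest index. -/
inductive Fml (L : FirstOrder.Language.{u, v}) : ℕ → Type (max u v)
  | rel {n k : ℕ} (R : L.Relations k) (ts : Fin k → Tm L n) : Fml L n
  | top {n : ℕ} : Fml L n
  | bot {n : ℕ} : Fml L n
  | neg {n : ℕ} (A : Fml L n) : Fml L n
  | and {n : ℕ} (A B : Fml L n) : Fml L n
  | or {n : ℕ} (A B : Fml L n) : Fml L n
  | imp {n : ℕ} (A B : Fml L n) : Fml L n
  | all {n : ℕ} (A : Fml L (n + 1)) : Fml L n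
  | ex {n : ℕ} (A : Fml L (n + 1)) : Fml L n

/-- A formula proper, all of whose bound variables are quantified (it may contain free variables). -/
abbrev Formula (L : FirstOrder.Language.{u, v}) : Type (max u v) := Fml L 0

variable {L : FirstOrder.Language.{u, v}}

/-- A substitution for the bound variables, carried under a quantifier. -/
def liftSubst {m n : ℕ} (σ : Fin m → Tm L n) : Fin (m + 1) → Tm L (n + 1) :=
  Fin.snoc (α := fun _ => Tm L (n + 1))
    (fun i => (σ i).relabel (Sum.map id Fin.castSucc)) (FirstOrder.Language.var (Sum.inr (Fin.last n)))

/-- Simultaneous substitution of terms for the bound variables; free variables are kept. -/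
def Fml.subst : {m n : ℕ} → Fml L m → (Fin m → Tm L n) → Fml L n
  | _, _, .rel R ts, σ =>
      .rel R fun i => (ts i).subst (Sum.elim (fun a => FirstOrder.Language.var (Sum.inl a)) σ)
  | _, _, .top, _ => .top
  | _, _, .bot, _ => .bot
  | _, _, .neg A, σ => .neg (A.subst σ)
  | _, _, .and A B, σ => .and (A.subst σ) (B.subst σ)
  | _, _, .or A B, σ => .or (A.subst σ) (B.subst σ)
  | _, _, .imp A B, σ => .imp (A.subst σ) (B.subst σ)
  | _, _, .all A, σ => .all (A.subst (liftSubst σ))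
  | _, _, .ex A, σ => .ex (A.subst (liftSubst σ))

/-- `A(t)`, for the body `A(x)` of a quantified formula. -/
def Fml.inst (A : Fml L 1) (t : Tm L 0) : Formula L := A.subst fun _ => t

/-- The free variable `a` as a term. -/
def freeVar (a : ℕ) : Tm L 0 := FirstOrder.Language.var (Sum.inl a)

/-- The free variables that occur in a term. -/
def Tm.freeVars {n : ℕ} : Tm L n → Set ℕ
  | .var (Sum.inl a) => {a}
  | .var (Sum.inr _) => ∅
  | .func _ ts => ⋃ i, Tm.freeVars (ts i)

/-- The function symbols (including constants) that occur in a term. -/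
def Tm.functions {n : ℕ} : Tm L n → Set (Σ k, L.Functions k)
  | .var _ => ∅
  | .func f ts => {⟨_, f⟩} ∪ ⋃ i, Tm.functions (ts i)

/-- The free variables that occur in a formula. -/
def Fml.freeVars : {n : ℕ} → Fml L n → Set ℕ
  | _, .rel _ ts => ⋃ i, Tm.freeVars (ts i)
  | _, .top => ∅
  | _, .bot => ∅
  | _, .neg A => A.freeVars
  | _, .and A B => A.freeVars ∪ B.freeVars
  | _, .or A B => A.freeVars ∪ B.freeVars
  | _, .imp A B => A.freeVars ∪ B.freeVars
  | _, .all A => A.freeVars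
  | _, .ex A => A.freeVars

/-- The function symbols (including constants) that occur in a formula. -/
def Fml.functions : {n : ℕ} → Fml L n → Set (Σ k, L.Functions k)
  | _, .rel _ ts => ⋃ i, Tm.functions (ts i)
  | _, .top => ∅
  | _, .bot => ∅
  | _, .neg A => A.functions
  | _, .and A B => A.functions ∪ B.functions
  | _, .or A B => A.functions ∪ B.functions
  | _, .imp A B => A.functions ∪ B.functions
  | _, .all A => A.functions
  | _, .ex A => A.functions

/-- The predicate symbols that occur in a formula. -/
def Fml.relations : {n : ℕ} → Fml L n → Set (Σ k, L.Relations k)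
  | _, .rel R _ => {⟨_, R⟩}
  | _, .top => ∅
  | _, .bot => ∅
  | _, .neg A => A.relations
  | _, .and A B => A.relations ∪ B.relations
  | _, .or A B => A.relations ∪ B.relations
  | _, .imp A B => A.relations ∪ B.relations
  | _, .all A => A.relations
  | _, .ex A => A.relations

/-- Every predicate symbol, function symbol, constant and free variable of `I` occurs both in `A`
and in `B`. -/
def InCommonLanguage (I A B : Formula L) : Prop :=
  I.relations ⊆ A.relations ∩ B.relations ∧
  I.functions ⊆ A.functions ∩ B.functions ∧
  I.freeVars ⊆ A.freeVars ∩ B.freeVars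

/-! ## The sequent calculus LK -/

/-- The variable `a` does not occur free in the cedent `Γ`. -/
def Fresh (a : ℕ) (Γ : Multiset (Formula L)) : Prop := ∀ C ∈ Γ, a ∉ C.freeVars

/-- `Provable Γ Δ`: the sequent `Γ → Δ` has a (cut-free) proof in LK. -/
inductive Provable : Multiset (Formula L) → Multiset (Formula L) → Prop
  | ax (A : Formula L) (Γ Δ : Multiset (Formula L)) : Provable (A ::ₘ Γ) (A ::ₘ Δ)
  | topR (Γ Δ : Multiset (Formula L)) : Provable Γ (.top ::ₘ Δ)
  | botL (Γ Δ : Multiset (Formula L)) : Provable (.bot ::ₘ Γ) Δ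
  | weakL {Γ Δ : Multiset (Formula L)} (A : Formula L) :
      Provable Γ Δ → Provable (A ::ₘ Γ) Δ
  | weakR {Γ Δ : Multiset (Formula L)} (A : Formula L) :
      Provable Γ Δ → Provable Γ (A ::ₘ Δ)
  | contrL {Γ Δ : Multiset (Formula L)} {A : Formula L} :
      Provable (A ::ₘ A ::ₘ Γ) Δ → Provable (A ::ₘ Γ) Δ
  | contrR {Γ Δ : Multiset (Formula L)} {A : Formula L} :
      Provable Γ (A ::ₘ A ::ₘ Δ) → Provable Γ (A ::ₘ Δ)
  | negL {Γ Δ : Multiset (Formula L)} {A : Formula L} :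
      Provable Γ (A ::ₘ Δ) → Provable (.neg A ::ₘ Γ) Δ
  | negR {Γ Δ : Multiset (Formula L)} {A : Formula L} :
      Provable (A ::ₘ Γ) Δ → Provable Γ (.neg A ::ₘ Δ)
  | andL {Γ Δ : Multiset (Formula L)} {A B : Formula L} :
      Provable (A ::ₘ B ::ₘ Γ) Δ → Provable (.and A B ::ₘ Γ) Δ
  | andR {Γ₁ Δ₁ Γ₂ Δ₂ : Multiset (Formula L)} {A B : Formula L} :
      Provable Γ₁ (A ::ₘ Δ₁) → Provable Γ₂ (B ::ₘ Δ₂) →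
      Provable (Γ₁ + Γ₂) (.and A B ::ₘ (Δ₁ + Δ₂))
  | orL {Γ₁ Δ₁ Γ₂ Δ₂ : Multiset (Formula L)} {A B : Formula L} :
      Provable (A ::ₘ Γ₁) Δ₁ → Provable (B ::ₘ Γ₂) Δ₂ →
      Provable (.or A B ::ₘ (Γ₁ + Γ₂)) (Δ₁ + Δ₂)
  | orR {Γ Δ : Multiset (Formula L)} {A B : Formula L} :
      Provable Γ (A ::ₘ B ::ₘ Δ) → Provable Γ (.or A B ::ₘ Δ)
  | impL {Γ₁ Δ₁ Γ₂ Δ₂ : Multiset (Formula L)} {A B : Formula L} :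
      Provable Γ₁ (A ::ₘ Δ₁) → Provable (B ::ₘ Γ₂) Δ₂ →
      Provable (.imp A B ::ₘ (Γ₁ + Γ₂)) (Δ₁ + Δ₂)
  | impR {Γ Δ : Multiset (Formula L)} {A B : Formula L} :
      Provable (A ::ₘ Γ) (B ::ₘ Δ) → Provable Γ (.imp A B ::ₘ Δ)
  | allL {Γ Δ : Multiset (Formula L)} {A : Fml L 1} (t : Tm L 0) :
      Provable (A.inst t ::ₘ Γ) Δ → Provable (.all A ::ₘ Γ) Δ
  | allR {Γ Δ : Multiset (Formula L)} {A : Fml L 1} (a : ℕ)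
      (hΓ : Fresh a Γ) (hΔ : Fresh a Δ) (hA : a ∉ A.freeVars) :
      Provable Γ (A.inst (freeVar a) ::ₘ Δ) → Provable Γ (.all A ::ₘ Δ)
  | exL {Γ Δ : Multiset (Formula L)} {A : Fml L 1} (a : ℕ)
      (hΓ : Fresh a Γ) (hΔ : Fresh a Δ) (hA : a ∉ A.freeVars) :
      Provable (A.inst (freeVar a) ::ₘ Γ) Δ → Provable (.ex A ::ₘ Γ) Δ
  | exR {Γ Δ : Multiset (Formula L)} {A : Fml L 1} (t : Tm L 0) :
      Provable Γ (A.inst t ::ₘ Δ) → Provable Γ (.ex A ::ₘ Δ)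

/-! ## The interpretation: occurrences as points, formulas as sets, rules as operators -/

/-- The occurrences of atomic formulas in a formula; `⊤` and `⊥` are the empty sets. -/
def Fml.Occ : {n : ℕ} → Fml L n → Type
  | _, .rel _ _ => Unit
  | _, .top => Empty
  | _, .bot => Empty
  | _, .neg A => A.Occ
  | _, .and A B => A.Occ ⊕ B.Occ
  | _, .or A B => A.Occ ⊕ B.Occ
  | _, .imp A B => A.Occ ⊕ B.Occ
  | _, .all A => A.Occ
  | _, .ex A => A.Occ

/-- The atomic occurrence in `A(x)` that corresponds to an atomic occurrence in `A(t)`. -/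
def Fml.occOfSubst : {m n : ℕ} → (A : Fml L m) → (σ : Fin m → Tm L n) → (A.subst σ).Occ → A.Occ
  | _, _, .rel _ _, _, x => x
  | _, _, .top, _, x => x
  | _, _, .bot, _, x => x
  | _, _, .neg A, σ, x => A.occOfSubst σ x
  | _, _, .and A B, σ, x => Sum.map (A.occOfSubst σ) (B.occOfSubst σ) x
  | _, _, .or A B, σ, x => Sum.map (A.occOfSubst σ) (B.occOfSubst σ) x
  | _, _, .imp A B, σ, x => Sum.map (A.occOfSubst σ) (B.occOfSubst σ) x
  | _, _, .all A, σ, x => A.occOfSubst (liftSubst σ) x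
  | _, _, .ex A, σ, x => A.occOfSubst (liftSubst σ) x

instance : HasPoints (Formula L) := ⟨Fml.Occ⟩

/-- The link given by a map between atomic occurrences. -/
def linkOf {B : Formula L} (A : Formula L) (f : A.Occ → B.Occ) : Link B where
  src := A
  rel x y := f x = y

theorem linkOf_isEmbedding {B : Formula L} (A : Formula L) (f : A.Occ → B.Occ) :
    (linkOf A f).IsEmbedding := fun x => ⟨f x, rfl⟩

/-- Contraction on side `i`. -/
def contrOp (i : Side) : Operator (Formula L) :=
  .ofTwo i i i (Formula L) (fun A => A) (fun A => linkOf A id) (fun A => linkOf A id)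
    (fun _ => linkOf_isEmbedding _ _) (fun _ => linkOf_isEmbedding _ _)

/-- The rule for negation with auxiliary formula on side `i`: it moves to the opposite side. -/
def negOp (i : Side) : Operator (Formula L) :=
  .ofOne i i.opp (Formula L) (fun A => .neg A) (fun A => linkOf (B := .neg A) A (fun x => x))
    (fun _ => linkOf_isEmbedding _ _) (fun _ _ => True)

/-- `∧`:left. -/
def andLOp : Operator (Formula L) :=
  .ofTwo .first .first .first (Formula L × Formula L) (fun p => .and p.1 p.2)
    (fun p => linkOf (B := .and p.1 p.2) p.1 Sum.inl)
    (fun p => linkOf (B := .and p.1 p.2) p.2 Sum.inr)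
    (fun _ => linkOf_isEmbedding _ _) (fun _ => linkOf_isEmbedding _ _)

/-- `∧`:right. -/
def andROp : Operator (Formula L) :=
  .ofPair .second .second .second (Formula L × Formula L) (fun p => .and p.1 p.2)
    (fun p => linkOf (B := .and p.1 p.2) p.1 Sum.inl)
    (fun p => linkOf (B := .and p.1 p.2) p.2 Sum.inr)
    (fun _ => linkOf_isEmbedding _ _) (fun _ => linkOf_isEmbedding _ _)

/-- `∨`:left. -/
def orLOp : Operator (Formula L) :=
  .ofPair .first .first .first (Formula L × Formula L) (fun p => .or p.1 p.2)
    (fun p => linkOf (B := .or p.1 p.2) p.1 Sum.inl)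
    (fun p => linkOf (B := .or p.1 p.2) p.2 Sum.inr)
    (fun _ => linkOf_isEmbedding _ _) (fun _ => linkOf_isEmbedding _ _)

/-- `∨`:right. -/
def orROp : Operator (Formula L) :=
  .ofTwo .second .second .second (Formula L × Formula L) (fun p => .or p.1 p.2)
    (fun p => linkOf (B := .or p.1 p.2) p.1 Sum.inl)
    (fun p => linkOf (B := .or p.1 p.2) p.2 Sum.inr)
    (fun _ => linkOf_isEmbedding _ _) (fun _ => linkOf_isEmbedding _ _)

/-- `⊃`:left. -/
def impLOp : Operator (Formula L) :=
  .ofPair .second .first .first (Formula L × Formula L) (fun p => .imp p.1 p.2)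
    (fun p => linkOf (B := .imp p.1 p.2) p.1 Sum.inl)
    (fun p => linkOf (B := .imp p.1 p.2) p.2 Sum.inr)
    (fun _ => linkOf_isEmbedding _ _) (fun _ => linkOf_isEmbedding _ _)

/-- `⊃`:right. -/
def impROp : Operator (Formula L) :=
  .ofTwo .first .second .second (Formula L × Formula L) (fun p => .imp p.1 p.2)
    (fun p => linkOf (B := .imp p.1 p.2) p.1 Sum.inl)
    (fun p => linkOf (B := .imp p.1 p.2) p.2 Sum.inr)
    (fun _ => linkOf_isEmbedding _ _) (fun _ => linkOf_isEmbedding _ _)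

/-- `∀`:left. -/
def allLOp : Operator (Formula L) :=
  .ofOne .first .first (Fml L 1 × Tm L 0) (fun p => .all p.1)
    (fun p => linkOf (B := .all p.1) (p.1.inst p.2) (p.1.occOfSubst _))
    (fun _ => linkOf_isEmbedding _ _) (fun _ _ => True)

/-- `∃`:right. -/
def exROp : Operator (Formula L) :=
  .ofOne .second .second (Fml L 1 × Tm L 0) (fun p => .ex p.1)
    (fun p => linkOf (B := .ex p.1) (p.1.inst p.2) (p.1.occOfSubst _))
    (fun _ => linkOf_isEmbedding _ _) (fun _ _ => True)

/-- A body `A(x)` with an eigenvariable `a`, which must not occur in `A(x)`. -/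
abbrev EigenInst (L : FirstOrder.Language.{u, v}) : Type (max u v) := {p : Fml L 1 × ℕ // p.2 ∉ p.1.freeVars}

/-- `∀`:right; the eigenvariable must not occur in the side formulas. -/
def allROp : Operator (Formula L) :=
  .ofOne .second .second (EigenInst L) (fun p => .all p.1.1)
    (fun p => linkOf (B := .all p.1.1) (p.1.1.inst (freeVar p.1.2)) (p.1.1.occOfSubst _))
    (fun _ => linkOf_isEmbedding _ _) (fun p C => ∀ i, Fresh p.1.2 (C i))

/-- `∃`:left; the eigenvariable must not occur in the side formulas. -/
def exLOp : Operator (Formula L) :=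
  .ofOne .first .first (EigenInst L) (fun p => .ex p.1.1)
    (fun p => linkOf (B := .ex p.1.1) (p.1.1.inst (freeVar p.1.2)) (p.1.1.occOfSubst _))
    (fun _ => linkOf_isEmbedding _ _) (fun p C => ∀ i, Fresh p.1.2 (C i))

/-- The rules of LK as operators.  (Weakening has no auxiliary formula, hence is not an operator; it
is absorbed by the side formulas of the initial sequents.) -/
def operators (L : FirstOrder.Language.{u, v}) : Set (Operator (Formula L)) :=
  {contrOp .first, contrOp .second, negOp .first, negOp .second, andLOp, andROp, orLOp, orROp,
    impLOp, impROp, allLOp, allROp, exLOp, exROp}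

/-- The sequent `Γ → Δ` as a structured set. -/
def sequent (Γ Δ : Multiset (Formula L)) : StructuredSet (Formula L)
  | .first => Γ
  | .second => Δ

/-- The initial sequents of LK as structured sets. -/
def initial (L : FirstOrder.Language.{u, v}) : Set (StructuredSet (Formula L)) :=
  {S | (∃ A, A ∈ S .first ∧ A ∈ S .second) ∨ .top ∈ S .second ∨ .bot ∈ S .first}

end LK

/-! The first and third claims rest on the tableau calculus `Tab`, whose lists only grow and whose
existential rule has no eigenvariable but one premise for every closed term. Weakening is then
trivial. `Provable.tab` translates LK proofs along a map θ of closed terms that commutes with the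
symbols of a signature; at an eigenvariable rule θ is altered so that the eigenvariable goes to an
arbitrary term, and one induction hypothesis yields all the premises. Conversely, `Tab.gen`
simulates each tableau rule by operators: a fresh variable selects one premise of the existential
rule, and the recreated formula is contracted with its old copy. Together with `Gen.provable` this
shows that weakening can be dispensed with. The round trip through LK also gives `Tab.map`:
contradictory lists stay contradictory when closed terms with a foreign head are replaced.

Interpolation is a Maehara-style induction on tableaux over a partition of the list into `X₁` and
`X₂`. The signatures `S₁`, `S₂` stay fixed (at the root, those of the two given formulas); the terms
brought in by quantifier rules are recorded as parameters, in finite sets `U₁`, `U₂` closed under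
subterms. An interpolant is built from common symbols and from alien terms, those whose head is not
common. The invariant is that every alien term lies inside an anchored one, that is, one whose
membership in `U₁` or `U₂` accounts for its foreign head. When a universal rule is undone,
parameters are withdrawn and alien terms may lose their anchor. `HasInterpolant.of_alien` then
quantifies them away, largest first: a term foreign to `S₁` and absent from `U₁` by ∀, a term
foreign to `S₂` and absent from `U₂` by ∃. Because of function symbols whole terms, not just
variables, must be generalized. At the root there are no parameters, hence no alien terms, and the
interpolant is in the common language.

Closure under regularity holds because the left and right rules of one binary connective have the
same value and the same links, with all components opposite. Up to order, ∧, ∨ and ⊃ cover all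
choices of two components, ¬ serves for arity one, and negating both values of a pair moves them to
the other components. -/

namespace LK

open Interp FirstOrder.Language

variable {L : FirstOrder.Language.{u, v}}

/-! ## Closed terms -/

/-- A closed term, regarded as a term in the presence of bound variables. -/
def Tm.ofClosed (n : ℕ) (s : Tm L 0) : Tm L n := s.relabel (Sum.map id Fin.elim0)

/-- Simultaneous substitution of terms for the bound variables of a term. -/
abbrev Tm.bsubst {m n : ℕ} (t : Tm L m) (σ : Fin m → Tm L n) : Tm L n :=
  t.subst (Sum.elim (fun a => var (Sum.inl a)) σ)

@[simp] theorem Tm.ofClosed_var (n a : ℕ) :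
    Tm.ofClosed n (var (Sum.inl a) : Tm L 0) = var (Sum.inl a) := rfl

@[simp] theorem Tm.ofClosed_func (n : ℕ) {k : ℕ} (f : L.Functions k) (ts : Fin k → Tm L 0) :
    Tm.ofClosed n (func f ts) = func f (fun i => Tm.ofClosed n (ts i)) := rfl

/-- Induction on closed terms. -/
@[elab_as_elim]
theorem Tm.closed_induction {p : Tm L 0 → Prop} (hvar : ∀ a, p (var (Sum.inl a)))
    (hfunc : ∀ {k : ℕ} (f : L.Functions k) (ts : Fin k → Tm L 0), (∀ i, p (ts i)) → p (func f ts))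
    (t : Tm L 0) : p t := by
  induction t with
  | var x =>
    rcases x with a | i
    · exact hvar a
    · exact i.elim0
  | func f ts ih => exact hfunc f ts ih

/-- Needed to invert `TermRel`: the closed term behind a `param` step can be recovered from its
image among terms with bound variables. -/
theorem Tm.ofClosed_injective (n : ℕ) : Function.Injective (Tm.ofClosed (L := L) n) := by
  intro s
  induction s using Tm.closed_induction with
  | hvar a =>
    rintro (⟨b | i⟩ | ⟨g, us⟩) h
    · simpa [Tm.ofClosed, FirstOrder.Language.Term.relabel] using h
    · exact i.elim0
    · cases h
  | hfunc f ts ih =>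
    rintro (⟨b | i⟩ | ⟨g, us⟩) h
    · cases h
    · exact i.elim0
    · simp only [Tm.ofClosed_func, FirstOrder.Language.Term.func.injEq] at h
      obtain ⟨rfl, h₁, h₂⟩ := h
      cases h₁
      congr 1
      funext i
      exact ih i (congrFun (eq_of_heq h₂) i)

@[simp] theorem Tm.ofClosed_zero (s : Tm L 0) : Tm.ofClosed 0 s = s := by
  induction s using Tm.closed_induction with
  | hvar a => rfl
  | hfunc f ts ih => simp [ih]

theorem Tm.ofClosed_ne_bvar {n : ℕ} (s : Tm L 0) (i : Fin n) :
    Tm.ofClosed n s ≠ var (Sum.inr i) := by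
  rcases s with (⟨b | j⟩ | ⟨g, us⟩) <;> intro h
  · simp [Tm.ofClosed, FirstOrder.Language.Term.relabel] at h
  · exact j.elim0
  · cases h

theorem Tm.ofClosed_eq_func {n k : ℕ} {s : Tm L 0} {f : L.Functions k} {ts : Fin k → Tm L n}
    (h : Tm.ofClosed n s = func f ts) :
    ∃ us : Fin k → Tm L 0, s = func f us ∧ ∀ i, ts i = Tm.ofClosed n (us i) := by
  rcases s with (⟨b | j⟩ | ⟨g, us⟩)
  · cases h
  · exact j.elim0
  · simp only [Tm.ofClosed_func, FirstOrder.Language.Term.func.injEq] at h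
    obtain ⟨rfl, h₁, h₂⟩ := h
    cases h₁
    exact ⟨us, rfl, fun i => (congrFun (eq_of_heq h₂) i).symm⟩

@[simp] theorem Tm.bsubst_ofClosed {m n : ℕ} (s : Tm L 0) (σ : Fin m → Tm L n) :
    (Tm.ofClosed m s).bsubst σ = Tm.ofClosed n s := by
  induction s using Tm.closed_induction with
  | hvar a => rfl
  | hfunc f ts ih =>
    simp only [Tm.ofClosed_func, FirstOrder.Language.Term.subst,
      FirstOrder.Language.Term.func.injEq, heq_eq_eq, true_and]
    exact funext ih

@[simp] theorem Tm.relabel_castSucc_ofClosed {n : ℕ} (s : Tm L 0) :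
    (Tm.ofClosed n s).relabel (Sum.map id Fin.castSucc) = Tm.ofClosed (n + 1) s := by
  induction s using Tm.closed_induction with
  | hvar a => rfl
  | hfunc f ts ih =>
    simp only [Tm.ofClosed_func, FirstOrder.Language.Term.relabel,
      FirstOrder.Language.Term.func.injEq, heq_eq_eq, true_and]
    exact funext ih

@[simp] theorem Tm.freeVars_ofClosed (n : ℕ) (s : Tm L 0) :
    (Tm.ofClosed n s).freeVars = s.freeVars := by
  induction s using Tm.closed_induction with
  | hvar a => rfl
  | hfunc f ts ih => simp [Tm.freeVars, ih]

theorem Tm.finite_freeVars {n : ℕ} (t : Tm L n) : t.freeVars.Finite := by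
  induction t with
  | var x => rcases x with a | i <;> simp [Tm.freeVars]
  | func f ts ih => exact Set.finite_iUnion ih

theorem Fml.finite_freeVars {n : ℕ} (A : Fml L n) : A.freeVars.Finite := by
  induction A with
  | rel R ts => exact Set.finite_iUnion fun i => Tm.finite_freeVars _
  | top | bot => exact Set.finite_empty
  | neg A ih | all A ih | ex A ih => exact ih
  | and A B ihA ihB | or A B ihA ihB | imp A B ihA ihB => exact ihA.union ihB

/-! ### Subterms and size of closed terms -/

/-- The subterms of a closed term. -/
def Tm.subterms : Tm L 0 → Set (Tm L 0)
  | .var x => {.var x}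
  | .func f ts => insert (.func f ts) (⋃ i, Tm.subterms (ts i))

theorem Tm.self_mem_subterms (t : Tm L 0) : t ∈ t.subterms := by
  cases t <;> simp [Tm.subterms]

theorem Tm.finite_subterms (t : Tm L 0) : t.subterms.Finite := by
  induction t with
  | var x => exact Set.finite_singleton _
  | func f ts ih => exact (Set.finite_iUnion ih).insert _

theorem Tm.subterms_subset {s t : Tm L 0} (h : s ∈ t.subterms) : s.subterms ⊆ t.subterms := by
  induction t with
  | var x => cases h; rfl
  | func f ts ih =>
    rcases h with rfl | h
    · rfl
    · obtain ⟨i, hi⟩ := Set.mem_iUnion.1 h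
      exact ((ih i hi).trans (Set.subset_iUnion (fun j => Tm.subterms (ts j)) i)).trans
        (Set.subset_insert _ _)

theorem Tm.arg_mem_subterms {k : ℕ} (f : L.Functions k) (ts : Fin k → Tm L 0) (i : Fin k) :
    ts i ∈ Tm.subterms (func f ts) :=
  Or.inr (Set.mem_iUnion.2 ⟨i, Tm.self_mem_subterms _⟩)

/-- The number of symbols of a term. -/
def Tm.size : Tm L 0 → ℕ
  | .var _ => 1
  | .func _ ts => (∑ i, Tm.size (ts i)) + 1

theorem Tm.size_lt_of_mem_subterms {s t : Tm L 0} (h : s ∈ t.subterms) (hne : s ≠ t) :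
    s.size < t.size := by
  induction t with
  | var x => exact absurd h hne
  | func f ts ih =>
    rcases h with rfl | h
    · exact absurd rfl hne
    · obtain ⟨i, hi⟩ := Set.mem_iUnion.1 h
      have h₁ : s.size ≤ Tm.size (ts i) := by
        by_cases hs : s = ts i
        · rw [hs]
        · exact (ih i hi hs).le
      have h₂ : Tm.size (ts i) ≤ ∑ j, Tm.size (ts j) :=
        Finset.single_le_sum (f := fun j => Tm.size (ts j)) (fun _ _ => Nat.zero_le _)
          (Finset.mem_univ i)
      simp only [Tm.size]
      omega

/-- A set of closed terms that contains the subterms of its members. -/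
def SubtermClosed (U : Set (Tm L 0)) : Prop := ∀ t ∈ U, t.subterms ⊆ U

theorem subtermClosed_subterms (t : Tm L 0) : SubtermClosed t.subterms :=
  fun _ h => Tm.subterms_subset h

theorem SubtermClosed.union {U V : Set (Tm L 0)} (hU : SubtermClosed U) (hV : SubtermClosed V) :
    SubtermClosed (U ∪ V) := by
  rintro t (h | h)
  · exact (hU t h).trans Set.subset_union_left
  · exact (hV t h).trans Set.subset_union_right

/-! ## Signatures and maps between closed terms -/

/-- A set of predicate symbols, and a set of free variables and function symbols. -/
structure Sig (L : FirstOrder.Language.{u, v}) where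
  rels : Set (Σ k, L.Relations k)
  syms : Set (ℕ ⊕ Σ k, L.Functions k)

/-- The free variable or function symbol at the head of a closed term. -/
def Tm.head : Tm L 0 → ℕ ⊕ Σ k, L.Functions k
  | .var (.inl a) => .inl a
  | .var (.inr i) => i.elim0
  | .func f _ => .inr ⟨_, f⟩

/-- A map between closed terms that commutes with the symbols of the signature. -/
structure IsHom (S : Sig L) (θ : Tm L 0 → Tm L 0) : Prop where
  var : ∀ a, Sum.inl a ∈ S.syms → θ (freeVar a) = freeVar a
  func : ∀ {k : ℕ} (f : L.Functions k) (ts : Fin k → Tm L 0), Sum.inr ⟨k, f⟩ ∈ S.syms →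
    θ (func f ts) = func f (fun i => θ (ts i))

theorem isHom_id (S : Sig L) : IsHom S id := ⟨fun _ _ => rfl, fun _ _ _ => rfl⟩

/-! ### Two ways of changing maps of closed terms: replacement and extension -/

open Classical in
/-- Replacement of a closed term by another one. -/
noncomputable def Tm.replace (d d' : Tm L 0) : Tm L 0 → Tm L 0
  | .var x => if .var x = d then d' else .var x
  | .func f ts => if .func f ts = d then d' else .func f (fun i => Tm.replace d d' (ts i))

theorem Tm.replace_self (d d' : Tm L 0) : Tm.replace d d' d = d' := by
  cases d <;> simp [Tm.replace]

theorem Tm.replace_of_notMem {d d' t : Tm L 0} (h : d ∉ t.subterms) : Tm.replace d d' t = t := by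
  have hne : t ≠ d := fun e => h (e ▸ Tm.self_mem_subterms t)
  induction t with
  | var x => rw [Tm.replace, if_neg hne]
  | func f ts ih =>
    rw [Tm.replace, if_neg hne]
    congr 1
    funext i
    have hi : d ∉ Tm.subterms (ts i) := fun hi => h (Or.inr (Set.mem_iUnion.2 ⟨i, hi⟩))
    exact ih i hi fun e => hi (e ▸ Tm.self_mem_subterms _)

/-- A term whose head is a symbol of `S` is never `d` itself, so the replacement passes to its
arguments. -/
theorem isHom_replace {S : Sig L} {d : Tm L 0} (d' : Tm L 0) (h : d.head ∉ S.syms) :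
    IsHom S (Tm.replace d d') where
  var a ha := if_neg fun e => by subst e; exact h ha
  func f ts hf := if_neg fun e => by subst e; exact h hf

open Classical in
/-- The value `v` is given to the free variable `a`, and a map between closed terms is changed
accordingly on the terms that contain `a`. -/
noncomputable def Tm.extend (θ : Tm L 0 → Tm L 0) (a : ℕ) (v : Tm L 0) : Tm L 0 → Tm L 0
  | .var x => if a ∈ Tm.freeVars (.var x : Tm L 0) then v else θ (.var x)
  | .func f ts => if a ∈ Tm.freeVars (.func f ts) then .func f (fun i => Tm.extend θ a v (ts i))
      else θ (.func f ts)

theorem Tm.extend_self (θ : Tm L 0 → Tm L 0) (a : ℕ) (v : Tm L 0) :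
    Tm.extend θ a v (freeVar a) = v := if_pos rfl

theorem Tm.extend_of_notMem {θ : Tm L 0 → Tm L 0} {a : ℕ} {v t : Tm L 0} (h : a ∉ t.freeVars) :
    Tm.extend θ a v t = θ t := by
  cases t <;> rw [Tm.extend, if_neg h]

/-- The signature without the free variable `a`. -/
def Sig.erase (S : Sig L) (a : ℕ) : Sig L := ⟨S.rels, S.syms \ {Sum.inl a}⟩

/-- Terms that contain `a` are mapped symbol by symbol, and on the others θ is kept. The variable
`a` leaves the signature, as it is now a parameter with the prescribed value `v`. -/
theorem IsHom.extend {S : Sig L} {θ : Tm L 0 → Tm L 0} (h : IsHom S θ) (a : ℕ) (v : Tm L 0) :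
    IsHom (S.erase a) (Tm.extend θ a v) where
  var b hb := by
    rw [Tm.extend_of_notMem, h.var b hb.1]
    rintro rfl
    exact hb.2 rfl
  func f ts hf := by
    by_cases ha : a ∈ Tm.freeVars (.func f ts)
    · rw [Tm.extend, if_pos ha]
    · rw [Tm.extend_of_notMem ha, h.func f ts hf.1]
      congr 1
      funext i
      rw [Tm.extend_of_notMem fun hi => ha (Set.mem_iUnion.2 ⟨i, hi⟩)]

/-! ## Formulas related by a map of the closed terms outside a signature -/

/-- `t'` results from `t`, which is built from the symbols of `S` and from closed terms, when these
closed terms are replaced as prescribed by `r`. -/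
inductive TermRel (S : Sig L) (r : Tm L 0 → Tm L 0 → Prop) {n : ℕ} : Tm L n → Tm L n → Prop
  | param {s s' : Tm L 0} : r s s' → TermRel S r (Tm.ofClosed n s) (Tm.ofClosed n s')
  | bvar (i : Fin n) : TermRel S r (var (Sum.inr i)) (var (Sum.inr i))
  | fvar (a : ℕ) : Sum.inl a ∈ S.syms → TermRel S r (var (Sum.inl a)) (var (Sum.inl a))
  | func {k : ℕ} (f : L.Functions k) (ts ts' : Fin k → Tm L n) : Sum.inr ⟨k, f⟩ ∈ S.syms →
      (∀ i, TermRel S r (ts i) (ts' i)) → TermRel S r (func f ts) (func f ts')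

variable {S S₁ S₂ : Sig L} {r r₁ r₂ : Tm L 0 → Tm L 0 → Prop} {n : ℕ}

theorem TermRel.bvar_inv {i : Fin n} {t' : Tm L n} (h : TermRel S r (var (Sum.inr i)) t') :
    t' = var (Sum.inr i) := by
  generalize ht : (var (Sum.inr i) : Tm L n) = t at h
  cases h with
  | param h => exact absurd ht.symm (Tm.ofClosed_ne_bvar _ _)
  | bvar j => rfl
  | fvar a => cases ht
  | func f ts ts' => cases ht

theorem TermRel.fvar_inv {a : ℕ} {t' : Tm L n} (h : TermRel S r (var (Sum.inl a)) t') :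
    (∃ s', r (var (Sum.inl a)) s' ∧ t' = Tm.ofClosed n s') ∨
      (Sum.inl a ∈ S.syms ∧ t' = var (Sum.inl a)) := by
  generalize ht : (var (Sum.inl a) : Tm L n) = t at h
  cases h with
  | param h =>
    cases Tm.ofClosed_injective n ((Tm.ofClosed_var n a).trans ht)
    exact Or.inl ⟨_, h, rfl⟩
  | bvar j => cases ht
  | fvar b hb => cases ht; exact Or.inr ⟨hb, rfl⟩
  | func f ts ts' => cases ht

theorem TermRel.func_inv {k : ℕ} {f : L.Functions k} {ts : Fin k → Tm L n} {t' : Tm L n}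
    (h : TermRel S r (FirstOrder.Language.func f ts) t') :
    (∃ s s', r s s' ∧ FirstOrder.Language.func f ts = Tm.ofClosed n s ∧ t' = Tm.ofClosed n s') ∨
      (Sum.inr ⟨k, f⟩ ∈ S.syms ∧ ∃ ts', t' = FirstOrder.Language.func f ts' ∧
        ∀ i, TermRel S r (ts i) (ts' i)) := by
  generalize ht : (FirstOrder.Language.func f ts : Tm L n) = t at h
  cases h with
  | param h => exact Or.inl ⟨_, _, h, rfl, rfl⟩
  | bvar j => cases ht
  | fvar b hb => cases ht
  | func g us us' hg hu => cases ht; exact Or.inr ⟨hg, us', rfl, hu⟩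

theorem TermRel.mono (hS : S₁.syms ⊆ S₂.syms) (hr : ∀ s s', r₁ s s' → r₂ s s') {t t' : Tm L n}
    (h : TermRel S₁ r₁ t t') : TermRel S₂ r₂ t t' := by
  induction h with
  | param h => exact .param (hr _ _ h)
  | bvar i => exact .bvar i
  | fvar a ha => exact .fvar a (hS ha)
  | func f ts ts' hf _ ih => exact .func f ts ts' (hS hf) ih

theorem TermRel.relabel_castSucc {t t' : Tm L n} (h : TermRel S r t t') :
    TermRel S r (t.relabel (Sum.map id Fin.castSucc)) (t'.relabel (Sum.map id Fin.castSucc)) := by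
  induction h with
  | param h => simpa using TermRel.param h
  | bvar i => exact .bvar _
  | fvar a ha => exact .fvar a ha
  | func f ts ts' hf _ ih => exact .func f _ _ hf ih

theorem TermRel.liftSubst {m : ℕ} {σ σ' : Fin m → Tm L n} (h : ∀ i, TermRel S r (σ i) (σ' i))
    (i : Fin (m + 1)) : TermRel S r (liftSubst σ i) (liftSubst σ' i) := by
  refine Fin.lastCases ?_ (fun j => ?_) i
  · simpa [LK.liftSubst] using TermRel.bvar (Fin.last n)
  · simpa [LK.liftSubst] using (h j).relabel_castSucc

theorem TermRel.bsubst {m : ℕ} {σ σ' : Fin m → Tm L n} (hσ : ∀ i, TermRel S r (σ i) (σ' i))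
    {t t' : Tm L m} (h : TermRel S r t t') : TermRel S r (t.bsubst σ) (t'.bsubst σ') := by
  induction h with
  | param h => simpa using TermRel.param h
  | bvar i => exact hσ i
  | fvar a ha => exact .fvar a ha
  | func f ts ts' hf _ ih => exact .func f _ _ hf ih

/-- The graph of a map between closed terms. -/
def graph (θ : Tm L 0 → Tm L 0) (s s' : Tm L 0) : Prop := s' = θ s

/-- A closed term can be parsed in several ways, since its upper part may be read as symbols of `S`
or as part of a parameter. The homomorphism property makes all readings give the same image. -/
theorem TermRel.eq_of_ofClosed {θ : Tm L 0 → Tm L 0} (hθ : IsHom S θ) {s : Tm L 0} {t' : Tm L n}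
    (h : TermRel S (graph θ) (Tm.ofClosed n s) t') : t' = Tm.ofClosed n (θ s) := by
  induction s using Tm.closed_induction generalizing t' with
  | hvar a =>
    rcases h.fvar_inv with ⟨s', rfl, rfl⟩ | ⟨ha, rfl⟩
    · rfl
    · exact congrArg (Tm.ofClosed n) (hθ.var a ha).symm
  | hfunc f ts ih =>
    rcases h.func_inv with ⟨s, s', rfl, e, rfl⟩ | ⟨hf, ts', rfl, hts⟩
    · cases Tm.ofClosed_injective n ((Tm.ofClosed_func n f ts).trans e)
      rfl
    · rw [hθ.func f ts hf, Tm.ofClosed_func]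
      congr 1
      exact funext fun i => ih i (hts i)

theorem TermRel.functional {θ : Tm L 0 → Tm L 0} (hθ : IsHom S θ) {t t₁ t₂ : Tm L n}
    (h₁ : TermRel S (graph θ) t t₁) (h₂ : TermRel S (graph θ) t t₂) : t₁ = t₂ := by
  induction h₁ generalizing t₂ with
  | param h => cases h; exact (h₂.eq_of_ofClosed hθ).symm
  | bvar i => exact h₂.bvar_inv.symm
  | fvar a ha =>
    refine Eq.trans ?_ (TermRel.eq_of_ofClosed (s := var (Sum.inl a)) hθ h₂).symm
    exact congrArg (Tm.ofClosed n) (hθ.var a ha).symm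
  | func f ts ts' hf h ih =>
    rcases h₂.func_inv with ⟨s, s', rfl, e, rfl⟩ | ⟨_, us, rfl, hu⟩
    · exact TermRel.eq_of_ofClosed hθ (e ▸ TermRel.func f ts ts' hf h)
    · congr 1
      exact funext fun i => ih i (hu i)

/-- Without `a` in `t`, no parameter of `t` is affected by the new value and no symbol used in `t`
is lost from the signature. -/
theorem TermRel.extend {θ : Tm L 0 → Tm L 0} {a : ℕ} (v : Tm L 0) {t t' : Tm L n}
    (h : TermRel S (graph θ) t t') (ha : a ∉ t.freeVars) :
    TermRel (S.erase a) (graph (Tm.extend θ a v)) t t' := by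
  induction h with
  | param h =>
    rw [Tm.freeVars_ofClosed] at ha
    exact .param (h.trans (Tm.extend_of_notMem ha).symm)
  | bvar i => exact .bvar i
  | fvar b hb => exact .fvar b ⟨hb, fun e => ha (Sum.inl_injective e).symm⟩
  | func f ts ts' hf _ ih =>
    exact .func f ts ts' ⟨hf, Sum.inr_ne_inl⟩ fun i =>
      ih i fun hi => ha (Set.mem_iUnion.2 ⟨i, hi⟩)

/-- `A'` results from `A`, which is built from the symbols of `S` and from closed terms, when these
closed terms are replaced as prescribed by `r`. -/
def FmlRel (S : Sig L) (r : Tm L 0 → Tm L 0 → Prop) : {n : ℕ} → Fml L n → Fml L n → Prop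
  | _, .rel (k := k) R ts, C =>
      ⟨k, R⟩ ∈ S.rels ∧ ∃ ts', C = .rel R ts' ∧ ∀ i, TermRel S r (ts i) (ts' i)
  | _, .top, C => C = .top
  | _, .bot, C => C = .bot
  | _, .neg A, C => ∃ A', C = .neg A' ∧ FmlRel S r A A'
  | _, .and A B, C => ∃ A' B', C = .and A' B' ∧ FmlRel S r A A' ∧ FmlRel S r B B'
  | _, .or A B, C => ∃ A' B', C = .or A' B' ∧ FmlRel S r A A' ∧ FmlRel S r B B'
  | _, .imp A B, C => ∃ A' B', C = .imp A' B' ∧ FmlRel S r A A' ∧ FmlRel S r B B'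
  | _, .all A, C => ∃ A', C = .all A' ∧ FmlRel S r A A'
  | _, .ex A, C => ∃ A', C = .ex A' ∧ FmlRel S r A A'

theorem FmlRel.mono (hR : S₁.rels ⊆ S₂.rels) (hS : S₁.syms ⊆ S₂.syms)
    (hr : ∀ s s', r₁ s s' → r₂ s s') {A A' : Fml L n}
    (h : FmlRel S₁ r₁ A A') : FmlRel S₂ r₂ A A' := by
  induction A with
  | rel R ts =>
    obtain ⟨hR', ts', rfl, h⟩ := h
    exact ⟨hR hR', ts', rfl, fun i => (h i).mono hS hr⟩
  | top | bot => exact h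
  | neg A ih | all A ih | ex A ih =>
    obtain ⟨A', rfl, h⟩ := h
    exact ⟨A', rfl, ih h⟩
  | and A B ihA ihB | or A B ihA ihB | imp A B ihA ihB =>
    obtain ⟨A', B', rfl, hA, hB⟩ := h
    exact ⟨A', B', rfl, ihA hA, ihB hB⟩

theorem FmlRel.subst {m : ℕ} {σ σ' : Fin m → Tm L n} (hσ : ∀ i, TermRel S r (σ i) (σ' i))
    {A A' : Fml L m} (h : FmlRel S r A A') : FmlRel S r (A.subst σ) (A'.subst σ') := by
  induction A generalizing n with
  | rel R ts =>
    obtain ⟨hR', ts', rfl, h⟩ := h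
    exact ⟨hR', _, rfl, fun i => (h i).bsubst hσ⟩
  | top | bot => cases h; rfl
  | neg A ih =>
    obtain ⟨A', rfl, h⟩ := h
    exact ⟨_, rfl, ih hσ h⟩
  | all A ih | ex A ih =>
    obtain ⟨A', rfl, h⟩ := h
    exact ⟨_, rfl, ih (TermRel.liftSubst hσ) h⟩
  | and A B ihA ihB | or A B ihA ihB | imp A B ihA ihB =>
    obtain ⟨A', B', rfl, hA, hB⟩ := h
    exact ⟨_, _, rfl, ihA hσ hA, ihB hσ hB⟩

/-- Lets a quantifier rule applied with `t` be mapped to the same rule applied with the image `t'`.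
-/
theorem FmlRel.inst {A A' : Fml L 1} (h : FmlRel S r A A') {t t' : Tm L 0} (ht : r t t') :
    FmlRel S r (A.inst t) (A'.inst t') :=
  h.subst fun _ => by simpa using TermRel.param (n := 0) (S := S) ht

theorem FmlRel.functional {θ : Tm L 0 → Tm L 0} (hθ : IsHom S θ) {A A₁ A₂ : Fml L n}
    (h₁ : FmlRel S (graph θ) A A₁) (h₂ : FmlRel S (graph θ) A A₂) : A₁ = A₂ := by
  induction A with
  | rel R ts =>
    obtain ⟨-, ts₁, rfl, h₁⟩ := h₁
    obtain ⟨-, ts₂, rfl, h₂⟩ := h₂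
    congr 1
    exact funext fun i => (h₁ i).functional hθ (h₂ i)
  | top | bot => exact h₁.trans h₂.symm
  | neg A ih | all A ih | ex A ih =>
    obtain ⟨A₁, rfl, h₁⟩ := h₁
    obtain ⟨A₂, rfl, h₂⟩ := h₂
    rw [ih h₁ h₂]
  | and A B ihA ihB | or A B ihA ihB | imp A B ihA ihB =>
    obtain ⟨A₁, B₁, rfl, hA₁, hB₁⟩ := h₁
    obtain ⟨A₂, B₂, rfl, hA₂, hB₂⟩ := h₂
    rw [ihA hA₁ hA₂, ihB hB₁ hB₂]

theorem FmlRel.extend {θ : Tm L 0 → Tm L 0} {a : ℕ} (v : Tm L 0) {A A' : Fml L n}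
    (h : FmlRel S (graph θ) A A') (ha : a ∉ A.freeVars) :
    FmlRel (S.erase a) (graph (Tm.extend θ a v)) A A' := by
  induction A with
  | rel R ts =>
    obtain ⟨hR, ts₁, rfl, h⟩ := h
    exact ⟨hR, ts₁, rfl, fun i => (h i).extend v fun hi => ha (Set.mem_iUnion.2 ⟨i, hi⟩)⟩
  | top | bot => exact h
  | neg A ih | all A ih | ex A ih =>
    obtain ⟨A', rfl, h⟩ := h
    exact ⟨A', rfl, ih h ha⟩
  | and A B ihA ihB | or A B ihA ihB | imp A B ihA ihB =>
    obtain ⟨A', B', rfl, hA, hB⟩ := h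
    exact ⟨A', B', rfl, ihA hA fun h => ha (Or.inl h), ihB hB fun h => ha (Or.inr h)⟩

end LK

namespace LK

open Interp FirstOrder.Language

variable {L : FirstOrder.Language.{u, v}} {S S₁ S₂ : Sig L} {U U₁ U₂ : Set (Tm L 0)} {n : ℕ}

/-! ## Formulas over a signature and a set of parameters -/

/-- The diagonal of a set of closed terms. -/
def diag (U : Set (Tm L 0)) (s s' : Tm L 0) : Prop := s = s' ∧ s ∈ U

/-- The formula is built from the symbols of `S` and from closed terms in `U`. -/
def Over (S : Sig L) (U : Set (Tm L 0)) (A : Fml L n) : Prop := FmlRel S (diag U) A A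

theorem Over.fmlRel {A : Fml L n} (h : Over S U A) {r : Tm L 0 → Tm L 0 → Prop}
    (hr : ∀ s ∈ U, r s s) : FmlRel S r A A :=
  FmlRel.mono subset_rfl subset_rfl (by rintro s _ ⟨rfl, hs⟩; exact hr s hs) h

theorem Over.mono {A : Fml L n} (h : Over S U₁ A) (hU : U₁ ⊆ U₂) : Over S U₂ A :=
  h.fmlRel fun _ hs => ⟨rfl, hU hs⟩

theorem Over.inst {A : Fml L 1} (h : Over S U A) {t : Tm L 0} (ht : t ∈ U) :
    Over S U (A.inst t) :=
  FmlRel.inst h ⟨rfl, ht⟩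

theorem over_neg {A : Fml L n} : Over S U (.neg A) ↔ Over S U A :=
  ⟨fun ⟨_, e, h⟩ => by cases e; exact h, fun h => ⟨_, rfl, h⟩⟩

theorem over_and {A B : Fml L n} : Over S U (.and A B) ↔ Over S U A ∧ Over S U B :=
  ⟨fun ⟨_, _, e, h⟩ => by cases e; exact h, fun h => ⟨_, _, rfl, h⟩⟩

theorem over_or {A B : Fml L n} : Over S U (.or A B) ↔ Over S U A ∧ Over S U B :=
  ⟨fun ⟨_, _, e, h⟩ => by cases e; exact h, fun h => ⟨_, _, rfl, h⟩⟩

theorem over_imp {A B : Fml L n} : Over S U (.imp A B) ↔ Over S U A ∧ Over S U B :=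
  ⟨fun ⟨_, _, e, h⟩ => by cases e; exact h, fun h => ⟨_, _, rfl, h⟩⟩

theorem over_all {A : Fml L (n + 1)} : Over S U (.all A) ↔ Over S U A :=
  ⟨fun ⟨_, e, h⟩ => by cases e; exact h, fun h => ⟨_, rfl, h⟩⟩

theorem over_ex {A : Fml L (n + 1)} : Over S U (.ex A) ↔ Over S U A :=
  ⟨fun ⟨_, e, h⟩ => by cases e; exact h, fun h => ⟨_, rfl, h⟩⟩

theorem TermRel.self {t : Tm L n} (h : ∀ a ∈ t.freeVars, Sum.inl a ∈ S.syms)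
    (h' : ∀ f ∈ t.functions, Sum.inr f ∈ S.syms) (r : Tm L 0 → Tm L 0 → Prop) :
    TermRel S r t t := by
  induction t with
  | var x =>
    rcases x with a | i
    · exact .fvar a (h a rfl)
    · exact .bvar i
  | func f ts ih =>
    exact .func f ts ts (h' _ (Or.inl rfl)) fun i =>
      ih i (fun a ha => h a (Set.mem_iUnion.2 ⟨i, ha⟩))
        fun g hg => h' g (Or.inr (Set.mem_iUnion.2 ⟨i, hg⟩))

theorem FmlRel.self {A : Fml L n} (hR : A.relations ⊆ S.rels)
    (h : ∀ a ∈ A.freeVars, Sum.inl a ∈ S.syms)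
    (h' : ∀ f ∈ A.functions, Sum.inr f ∈ S.syms) (r : Tm L 0 → Tm L 0 → Prop) :
    FmlRel S r A A := by
  induction A with
  | rel R ts =>
    exact ⟨hR rfl, ts, rfl, fun i => TermRel.self (fun a ha => h a (Set.mem_iUnion.2 ⟨i, ha⟩))
      (fun g hg => h' g (Set.mem_iUnion.2 ⟨i, hg⟩)) r⟩
  | top | bot => rfl
  | neg A ih | all A ih | ex A ih => exact ⟨A, rfl, ih hR h h'⟩
  | and A B ihA ihB | or A B ihA ihB | imp A B ihA ihB =>
    exact ⟨A, B, rfl,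
      ihA (Set.subset_union_left.trans hR) (fun a ha => h a (Or.inl ha))
        fun f hf => h' f (Or.inl hf),
      ihB (Set.subset_union_right.trans hR) (fun a ha => h a (Or.inr ha))
        fun f hf => h' f (Or.inr hf)⟩

theorem TermRel.symbols_subset {t t' : Tm L n} (h : TermRel S (diag ∅) t t') :
    (∀ a ∈ t.freeVars, Sum.inl a ∈ S.syms) ∧ ∀ f ∈ t.functions, Sum.inr f ∈ S.syms := by
  induction h with
  | param h => exact h.2.elim
  | bvar i => exact ⟨fun _ h => h.elim, fun _ h => h.elim⟩
  | fvar a ha => exact ⟨fun _ h => by cases h; exact ha, fun _ h => h.elim⟩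
  | func f ts ts' hf _ ih =>
    constructor
    · intro a ha
      obtain ⟨i, hi⟩ := Set.mem_iUnion.1 ha
      exact (ih i).1 a hi
    · rintro g (rfl | hg)
      · exact hf
      · obtain ⟨i, hi⟩ := Set.mem_iUnion.1 hg
        exact (ih i).2 g hi

theorem Over.symbols_subset {A : Fml L n} (h : Over S ∅ A) :
    A.relations ⊆ S.rels ∧ (∀ a ∈ A.freeVars, Sum.inl a ∈ S.syms) ∧
      ∀ f ∈ A.functions, Sum.inr f ∈ S.syms := by
  induction A with
  | rel R ts =>
    obtain ⟨hR, ts', -, h⟩ := h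
    refine ⟨Set.singleton_subset_iff.2 hR, fun a ha => ?_, fun f hf => ?_⟩
    · obtain ⟨i, hi⟩ := Set.mem_iUnion.1 ha
      exact (h i).symbols_subset.1 a hi
    · obtain ⟨i, hi⟩ := Set.mem_iUnion.1 hf
      exact (h i).symbols_subset.2 f hi
  | top | bot => exact ⟨Set.empty_subset _, fun _ h => h.elim, fun _ h => h.elim⟩
  | neg A ih => exact ih (over_neg.1 h)
  | all A ih => exact ih (over_all.1 h)
  | ex A ih => exact ih (over_ex.1 h)
  | and A B ihA ihB =>
    obtain ⟨hA, hB⟩ := over_and.1 h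
    exact ⟨Set.union_subset (ihA hA).1 (ihB hB).1,
      fun a ha => ha.elim ((ihA hA).2.1 a) ((ihB hB).2.1 a),
      fun a ha => ha.elim ((ihA hA).2.2 a) ((ihB hB).2.2 a)⟩
  | or A B ihA ihB =>
    obtain ⟨hA, hB⟩ := over_or.1 h
    exact ⟨Set.union_subset (ihA hA).1 (ihB hB).1,
      fun a ha => ha.elim ((ihA hA).2.1 a) ((ihB hB).2.1 a),
      fun a ha => ha.elim ((ihA hA).2.2 a) ((ihB hB).2.2 a)⟩
  | imp A B ihA ihB =>
    obtain ⟨hA, hB⟩ := over_imp.1 h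
    exact ⟨Set.union_subset (ihA hA).1 (ihB hB).1,
      fun a ha => ha.elim ((ihA hA).2.1 a) ((ihB hB).2.1 a),
      fun a ha => ha.elim ((ihA hA).2.2 a) ((ihB hB).2.2 a)⟩

/-! ### Abstraction from a parameter -/

/-- The substitution of the closed term `d` for the first bound variable, which is removed. -/
def headSubst (d : Tm L 0) (n : ℕ) : Fin (n + 1) → Tm L n :=
  Fin.cons (Tm.ofClosed n d) fun i => var (Sum.inr i)

/-- The abstracted variable receives the smallest index while quantifiers bind the largest one, so
passing under a quantifier does not disturb it. -/
theorem liftSubst_headSubst (d : Tm L 0) (n : ℕ) :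
    liftSubst (headSubst d n) = headSubst d (n + 1) := by
  funext i
  refine Fin.lastCases ?_ (fun j => ?_) i
  · rw [← Fin.succ_last]
    simp [liftSubst, headSubst]
  · refine Fin.cases ?_ (fun j => ?_) j
    · simp only [liftSubst, Fin.snoc_castSucc]
      simp [headSubst]
    · simp only [liftSubst, Fin.snoc_castSucc]
      rw [← Fin.succ_castSucc]
      simp [headSubst, FirstOrder.Language.Term.relabel]

theorem Fml.subst_headSubst_zero (K : Fml L 1) (d : Tm L 0) :
    K.subst (headSubst d 0) = K.inst d := by
  congr 1
  funext i
  have hi : i = 0 := Subsingleton.elim (α := Fin 1) i 0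
  rw [hi]
  simp [headSubst]

/-- Each occurrence of `d` that is used as a parameter becomes the new bound variable 0, and the old
bound variables are shifted up by one. -/
theorem TermRel.exists_abstract {d : Tm L 0} {t t' : Tm L n}
    (h : TermRel S (diag (insert d U)) t t') :
    ∃ k : Tm L (n + 1), TermRel S (diag U) k k ∧ k.bsubst (headSubst d n) = t := by
  induction h with
  | @param s s' h =>
    rcases h.2 with rfl | hs
    · exact ⟨var (Sum.inr 0), .bvar 0, rfl⟩
    · exact ⟨Tm.ofClosed _ s, .param ⟨rfl, hs⟩, by simp⟩
  | bvar i => exact ⟨var (Sum.inr i.succ), .bvar _, rfl⟩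
  | fvar a ha => exact ⟨var (Sum.inl a), .fvar a ha, rfl⟩
  | func f ts ts' hf _ ih =>
    choose ks hk hks using ih
    exact ⟨FirstOrder.Language.func f ks, .func f ks ks hf hk,
      congrArg (FirstOrder.Language.func f) (funext hks)⟩

theorem Over.exists_abstract {d : Tm L 0} {A : Fml L n} (h : Over S (insert d U) A) :
    ∃ K : Fml L (n + 1), Over S U K ∧ K.subst (headSubst d n) = A := by
  induction A with
  | rel R ts =>
    obtain ⟨hR, ts', -, h⟩ := h
    choose ks hk hks using fun i => (h i).exists_abstract
    exact ⟨.rel R ks, ⟨hR, ks, rfl, hk⟩, congrArg (Fml.rel R) (funext hks)⟩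
  | top => exact ⟨.top, rfl, rfl⟩
  | bot => exact ⟨.bot, rfl, rfl⟩
  | neg A ih =>
    obtain ⟨K, hK, rfl⟩ := ih (over_neg.1 h)
    exact ⟨.neg K, over_neg.2 hK, rfl⟩
  | all A ih =>
    obtain ⟨K, hK, rfl⟩ := ih (over_all.1 h)
    exact ⟨.all K, over_all.2 hK, by rw [Fml.subst, liftSubst_headSubst]⟩
  | ex A ih =>
    obtain ⟨K, hK, rfl⟩ := ih (over_ex.1 h)
    exact ⟨.ex K, over_ex.2 hK, by rw [Fml.subst, liftSubst_headSubst]⟩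
  | and A B ihA ihB =>
    obtain ⟨K, hK, rfl⟩ := ihA (over_and.1 h).1
    obtain ⟨M, hM, rfl⟩ := ihB (over_and.1 h).2
    exact ⟨.and K M, over_and.2 ⟨hK, hM⟩, rfl⟩
  | or A B ihA ihB =>
    obtain ⟨K, hK, rfl⟩ := ihA (over_or.1 h).1
    obtain ⟨M, hM, rfl⟩ := ihB (over_or.1 h).2
    exact ⟨.or K M, over_or.2 ⟨hK, hM⟩, rfl⟩
  | imp A B ihA ihB =>
    obtain ⟨K, hK, rfl⟩ := ihA (over_imp.1 h).1
    obtain ⟨M, hM, rfl⟩ := ihB (over_imp.1 h).2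
    exact ⟨.imp K M, over_imp.2 ⟨hK, hM⟩, rfl⟩

/-- Every formula over `U` and a closed term `d` is an instance, for `d`, of a formula over `U`. -/
theorem Over.exists_inst_eq {d : Tm L 0} {A : Formula L} (h : Over S (insert d U) A) :
    ∃ K : Fml L 1, Over S U K ∧ K.inst d = A := by
  obtain ⟨K, hK, rfl⟩ := h.exists_abstract
  exact ⟨K, hK, (K.subst_headSubst_zero d).symm⟩

/-! ### Formulas over two signatures -/

/-- The common part of two signatures. -/
def Sig.inter (S₁ S₂ : Sig L) : Sig L := ⟨S₁.rels ∩ S₂.rels, S₁.syms ∩ S₂.syms⟩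

/-- The closed term does not begin with a symbol common to `S₁` and `S₂`. -/
def Alien (S₁ S₂ : Sig L) (s : Tm L 0) : Prop := s.head ∉ S₁.syms ∨ s.head ∉ S₂.syms

/-- If the head of the closed term is not a symbol of one of the signatures, then the term belongs
to the corresponding set of parameters. -/
def Anchored (S₁ S₂ : Sig L) (U₁ U₂ : Set (Tm L 0)) (s : Tm L 0) : Prop :=
  (s.head ∉ S₁.syms → s ∈ U₁) ∧ (s.head ∉ S₂.syms → s ∈ U₂)

/-- A head outside the signature can only have come in through a `param` step at the root of the
term. -/
theorem TermRel.mem_of_head_notMem {s : Tm L 0} {t' : Tm L n}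
    (h : TermRel S (diag U) (Tm.ofClosed n s) t') (hs : s.head ∉ S.syms) : s ∈ U := by
  generalize ht : Tm.ofClosed n s = t at h
  cases h with
  | param h => rw [Tm.ofClosed_injective n ht]; exact h.2
  | bvar i => exact absurd ht (Tm.ofClosed_ne_bvar _ _)
  | fvar a ha =>
    cases Tm.ofClosed_injective n (ht.trans (Tm.ofClosed_var n a).symm)
    exact absurd ha hs
  | func f ts ts' hf =>
    obtain ⟨us, rfl, -⟩ := Tm.ofClosed_eq_func ht
    exact absurd hf hs

theorem TermRel.arg (hU : SubtermClosed U) {k : ℕ} {f : L.Functions k} {ts : Fin k → Tm L n}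
    {t' : Tm L n} (h : TermRel S (diag U) (FirstOrder.Language.func f ts) t') (i : Fin k) :
    ∃ t'', TermRel S (diag U) (ts i) t'' := by
  rcases h.func_inv with ⟨s, s', hs, e, rfl⟩ | ⟨_, ts', rfl, hts⟩
  · obtain ⟨us, rfl, hus⟩ := Tm.ofClosed_eq_func e.symm
    rw [hus i]
    exact ⟨_, .param ⟨rfl, hU _ hs.2 (Tm.arg_mem_subterms f us i)⟩⟩
  · exact ⟨_, hts i⟩

/-- The term is read from the root downwards as long as its symbols are common. Where this stops,
the subterm is alien, and a head missing from `S₁` or `S₂` forces membership in `U₁` or `U₂`.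
Subterm closure is what permits the descent into the arguments of a parameter. -/
theorem TermRel.inter (hU₁ : SubtermClosed U₁) (hU₂ : SubtermClosed U₂) {t t₁ t₂ : Tm L n}
    (h₁ : TermRel S₁ (diag U₁) t t₁) (h₂ : TermRel S₂ (diag U₂) t t₂) :
    TermRel (S₁.inter S₂) (diag {s | Alien S₁ S₂ s ∧ Anchored S₁ S₂ U₁ U₂ s}) t t := by
  have closed : ∀ s, Tm.ofClosed n s = t → Alien S₁ S₂ s →
      TermRel (S₁.inter S₂) (diag {s | Alien S₁ S₂ s ∧ Anchored S₁ S₂ U₁ U₂ s}) t t := by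
    rintro s rfl hs
    exact .param ⟨rfl, hs, h₁.mem_of_head_notMem, h₂.mem_of_head_notMem⟩
  induction t generalizing t₁ t₂ with
  | var x =>
    rcases x with a | i
    · by_cases ha : Sum.inl a ∈ S₁.syms ∧ Sum.inl a ∈ S₂.syms
      · exact .fvar a ha
      · exact closed (var (Sum.inl a)) rfl (not_and_or.1 ha)
    · exact .bvar i
  | @func k f ts ih =>
    by_cases hf : Sum.inr ⟨k, f⟩ ∈ S₁.syms ∧ Sum.inr ⟨k, f⟩ ∈ S₂.syms
    · refine .func f ts ts hf fun i => ?_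
      obtain ⟨t₁', h₁'⟩ := h₁.arg hU₁ i
      obtain ⟨t₂', h₂'⟩ := h₂.arg hU₂ i
      refine ih i h₁' h₂' ?_
      rintro s hs hal
      rw [← hs] at h₁' h₂' ⊢
      exact .param ⟨rfl, hal, h₁'.mem_of_head_notMem, h₂'.mem_of_head_notMem⟩
    -- One of the signatures lacks `f`, so there the whole term must be a parameter; hence it
    -- contains no bound variable.
    · have : ∃ s, Tm.ofClosed n s = FirstOrder.Language.func f ts := by
        rcases h₁.func_inv with ⟨s, _, _, e, _⟩ | ⟨hf₁, _⟩
        · exact ⟨s, e.symm⟩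
        · rcases h₂.func_inv with ⟨s, _, _, e, _⟩ | ⟨hf₂, _⟩
          · exact ⟨s, e.symm⟩
          · exact absurd ⟨hf₁, hf₂⟩ hf
      obtain ⟨s, hs⟩ := this
      refine closed s hs ?_
      obtain ⟨us, rfl, -⟩ := Tm.ofClosed_eq_func hs
      exact not_and_or.1 hf

theorem Over.inter (hU₁ : SubtermClosed U₁) (hU₂ : SubtermClosed U₂) {A : Fml L n}
    (h₁ : Over S₁ U₁ A) (h₂ : Over S₂ U₂ A) :
    Over (S₁.inter S₂) {s | Alien S₁ S₂ s ∧ Anchored S₁ S₂ U₁ U₂ s} A := by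
  induction A with
  | rel R ts =>
    obtain ⟨hR₁, _, -, h₁⟩ := h₁
    obtain ⟨hR₂, _, -, h₂⟩ := h₂
    exact ⟨⟨hR₁, hR₂⟩, ts, rfl, fun i => (h₁ i).inter hU₁ hU₂ (h₂ i)⟩
  | top | bot => rfl
  | neg A ih => exact over_neg.2 (ih (over_neg.1 h₁) (over_neg.1 h₂))
  | all A ih => exact over_all.2 (ih (over_all.1 h₁) (over_all.1 h₂))
  | ex A ih => exact over_ex.2 (ih (over_ex.1 h₁) (over_ex.1 h₂))
  | and A B ihA ihB =>
    exact over_and.2 ⟨ihA (over_and.1 h₁).1 (over_and.1 h₂).1,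
      ihB (over_and.1 h₁).2 (over_and.1 h₂).2⟩
  | or A B ihA ihB =>
    exact over_or.2 ⟨ihA (over_or.1 h₁).1 (over_or.1 h₂).1,
      ihB (over_or.1 h₁).2 (over_or.1 h₂).2⟩
  | imp A B ihA ihB =>
    exact over_imp.2 ⟨ihA (over_imp.1 h₁).1 (over_imp.1 h₂).1,
      ihB (over_imp.1 h₁).2 (over_imp.1 h₂).2⟩

end LK

namespace LK

open Interp FirstOrder.Language

variable {L : FirstOrder.Language.{u, v}}

/-! ## A calculus of signed formulas -/

/-- A formula together with the side of the sequent in which it stands. -/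
abbrev SFml (L : FirstOrder.Language.{u, v}) : Type (max u v) := Side × Formula L

/-- The conjunctive signed formulas and their components. -/
inductive Alpha : SFml L → SFml L → SFml L → Prop
  | neg (i : Side) (A : Formula L) : Alpha (i, .neg A) (i.opp, A) (i.opp, A)
  | and (A B : Formula L) : Alpha (.first, .and A B) (.first, A) (.first, B)
  | or (A B : Formula L) : Alpha (.second, .or A B) (.second, A) (.second, B)
  | imp (A B : Formula L) : Alpha (.second, .imp A B) (.first, A) (.second, B)

/-- The disjunctive signed formulas and their components. -/
inductive Beta : SFml L → SFml L → SFml L → Prop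
  | and (A B : Formula L) : Beta (.second, .and A B) (.second, A) (.second, B)
  | or (A B : Formula L) : Beta (.first, .or A B) (.first, A) (.first, B)
  | imp (A B : Formula L) : Beta (.first, .imp A B) (.second, A) (.first, B)

/-- The universal signed formulas and their bodies. -/
inductive Gamma : SFml L → Fml L 1 → Prop
  | all (A : Fml L 1) : Gamma (.first, .all A) A
  | ex (A : Fml L 1) : Gamma (.second, .ex A) A

/-- The existential signed formulas and their bodies. -/
inductive Delta : SFml L → Fml L 1 → Prop
  | all (A : Fml L 1) : Delta (.second, .all A) A
  | ex (A : Fml L 1) : Delta (.first, .ex A) A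

/-- Tableau proofs that a list of signed formulas is contradictory.  In the rule for existential
formulas all closed terms are witnesses. -/
inductive Tab : List (SFml L) → Prop
  | ax {X : List (SFml L)} (A : Formula L) : (.first, A) ∈ X → (.second, A) ∈ X → Tab X
  | top {X : List (SFml L)} : (.second, .top) ∈ X → Tab X
  | bot {X : List (SFml L)} : (.first, .bot) ∈ X → Tab X
  | alpha {X : List (SFml L)} {φ φ₁ φ₂ : SFml L} : Alpha φ φ₁ φ₂ → φ ∈ X →
      Tab (φ₁ :: φ₂ :: X) → Tab X
  | beta {X : List (SFml L)} {φ φ₁ φ₂ : SFml L} : Beta φ φ₁ φ₂ → φ ∈ X →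
      Tab (φ₁ :: X) → Tab (φ₂ :: X) → Tab X
  | gamma {X : List (SFml L)} {φ : SFml L} {A : Fml L 1} (t : Tm L 0) : Gamma φ A → φ ∈ X →
      Tab ((φ.1, A.inst t) :: X) → Tab X
  | delta {X : List (SFml L)} {φ : SFml L} {A : Fml L 1} : Delta φ A → φ ∈ X →
      (∀ t, Tab ((φ.1, A.inst t) :: X)) → Tab X

/-- No rule deletes a formula, and the existential rule carries no freshness condition that further
formulas could violate. -/
theorem Tab.mono {X Y : List (SFml L)} (h : Tab X) (hXY : X ⊆ Y) : Tab Y := by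
  induction h generalizing Y with
  | ax A h₁ h₂ => exact .ax A (hXY h₁) (hXY h₂)
  | top h => exact .top (hXY h)
  | bot h => exact .bot (hXY h)
  | alpha hφ h _ ih =>
    exact .alpha hφ (hXY h) (ih (List.cons_subset_cons _ (List.cons_subset_cons _ hXY)))
  | beta hφ h _ _ ih₁ ih₂ =>
    exact .beta hφ (hXY h) (ih₁ (List.cons_subset_cons _ hXY)) (ih₂ (List.cons_subset_cons _ hXY))
  | gamma t hφ h _ ih => exact .gamma t hφ (hXY h) (ih (List.cons_subset_cons _ hXY))
  | delta hφ h _ ih => exact .delta hφ (hXY h) fun t => ih t (List.cons_subset_cons _ hXY)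

/-! ### From LK proofs to tableaux -/

/-- `X` contains, on side `i`, an image under `θ` of every formula in `Γ`. -/
def Covers (S : Sig L) (θ : Tm L 0 → Tm L 0) (X : List (SFml L)) (i : Side)
    (Γ : Multiset (Formula L)) : Prop :=
  ∀ A ∈ Γ, ∃ A', FmlRel S (graph θ) A A' ∧ (i, A') ∈ X

variable {S : Sig L} {θ : Tm L 0 → Tm L 0} {X Y : List (SFml L)} {i : Side}
  {Γ Δ : Multiset (Formula L)}

theorem Covers.mono (h : Covers S θ X i Γ) (hXY : X ⊆ Y) : Covers S θ Y i Γ := fun A hA =>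
  let ⟨A', h₁, h₂⟩ := h A hA
  ⟨A', h₁, hXY h₂⟩

theorem Covers.weaken (h : Covers S θ X i Γ) (φ : SFml L) : Covers S θ (φ :: X) i Γ :=
  h.mono (List.subset_cons_self _ _)

theorem covers_cons {A : Formula L} : Covers S θ X i (A ::ₘ Γ) ↔
    (∃ A', FmlRel S (graph θ) A A' ∧ (i, A') ∈ X) ∧ Covers S θ X i Γ := by
  simp [Covers]

theorem covers_add : Covers S θ X i (Γ + Δ) ↔ Covers S θ X i Γ ∧ Covers S θ X i Δ := by
  simp [Covers, or_imp, forall_and]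

theorem Covers.cons (h : Covers S θ X i Γ) {A A' : Formula L} (hA : FmlRel S (graph θ) A A') :
    Covers S θ ((i, A') :: X) i (A ::ₘ Γ) :=
  covers_cons.2 ⟨⟨A', hA, List.mem_cons_self⟩, h.weaken _⟩

theorem Covers.extend (h : Covers S θ X i Γ) {a : ℕ} (ha : Fresh a Γ) (t : Tm L 0) :
    Covers (S.erase a) (Tm.extend θ a t) X i Γ := fun A hA =>
  let ⟨A', h₁, h₂⟩ := h A hA
  ⟨A', h₁.extend t (ha A hA), h₂⟩

/-- The signed formulas of the image of a provable sequent are contradictory.  This contains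
weakening, the renaming of free variables, and the replacement of closed terms. -/
theorem Provable.tab (h : Provable Γ Δ) {S : Sig L} {θ : Tm L 0 → Tm L 0} (hθ : IsHom S θ)
    {X : List (SFml L)} (hΓ : Covers S θ X .first Γ) (hΔ : Covers S θ X .second Δ) : Tab X := by
  induction h generalizing S θ X with
  | ax A Γ Δ =>
    obtain ⟨⟨A₁, h₁, hA₁⟩, -⟩ := covers_cons.1 hΓ
    obtain ⟨⟨A₂, h₂, hA₂⟩, -⟩ := covers_cons.1 hΔ
    -- The two copies of the axiom formula might have different images; that θ is a homomorphism
    -- excludes this.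
    cases h₁.functional hθ h₂
    exact .ax _ hA₁ hA₂
  | topR Γ Δ =>
    obtain ⟨⟨_, rfl, h⟩, -⟩ := covers_cons.1 hΔ
    exact .top h
  | botL Γ Δ =>
    obtain ⟨⟨_, rfl, h⟩, -⟩ := covers_cons.1 hΓ
    exact .bot h
  | weakL A _ ih => exact ih hθ (covers_cons.1 hΓ).2 hΔ
  | weakR A _ ih => exact ih hθ hΓ (covers_cons.1 hΔ).2
  | contrL _ ih => exact ih hθ (covers_cons.2 ⟨(covers_cons.1 hΓ).1, hΓ⟩) hΔ
  | contrR _ ih => exact ih hθ hΓ (covers_cons.2 ⟨(covers_cons.1 hΔ).1, hΔ⟩)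
  | negL _ ih =>
    obtain ⟨⟨_, ⟨A, rfl, hA⟩, h⟩, hΓ⟩ := covers_cons.1 hΓ
    exact .alpha (.neg _ A) h (ih hθ ((hΓ.weaken _).weaken _) ((hΔ.weaken _).cons hA))
  | negR _ ih =>
    obtain ⟨⟨_, ⟨A, rfl, hA⟩, h⟩, hΔ⟩ := covers_cons.1 hΔ
    exact .alpha (.neg _ A) h (ih hθ ((hΓ.weaken _).cons hA) ((hΔ.weaken _).weaken _))
  | andL _ ih =>
    obtain ⟨⟨_, ⟨A, B, rfl, hA, hB⟩, h⟩, hΓ⟩ := covers_cons.1 hΓ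
    exact .alpha (.and A B) h (ih hθ ((hΓ.cons hB).cons hA) ((hΔ.weaken _).weaken _))
  | andR _ _ ih₁ ih₂ =>
    obtain ⟨⟨_, ⟨A, B, rfl, hA, hB⟩, h⟩, hΔ⟩ := covers_cons.1 hΔ
    obtain ⟨hΔ₁, hΔ₂⟩ := covers_add.1 hΔ
    obtain ⟨hΓ₁, hΓ₂⟩ := covers_add.1 hΓ
    exact .beta (.and A B) h (ih₁ hθ (hΓ₁.weaken _) (hΔ₁.cons hA))
      (ih₂ hθ (hΓ₂.weaken _) (hΔ₂.cons hB))
  | orL _ _ ih₁ ih₂ =>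
    obtain ⟨⟨_, ⟨A, B, rfl, hA, hB⟩, h⟩, hΓ⟩ := covers_cons.1 hΓ
    obtain ⟨hΔ₁, hΔ₂⟩ := covers_add.1 hΔ
    obtain ⟨hΓ₁, hΓ₂⟩ := covers_add.1 hΓ
    exact .beta (.or A B) h (ih₁ hθ (hΓ₁.cons hA) (hΔ₁.weaken _))
      (ih₂ hθ (hΓ₂.cons hB) (hΔ₂.weaken _))
  | orR _ ih =>
    obtain ⟨⟨_, ⟨A, B, rfl, hA, hB⟩, h⟩, hΔ⟩ := covers_cons.1 hΔ
    exact .alpha (.or A B) h (ih hθ ((hΓ.weaken _).weaken _) ((hΔ.cons hB).cons hA))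
  | impL _ _ ih₁ ih₂ =>
    obtain ⟨⟨_, ⟨A, B, rfl, hA, hB⟩, h⟩, hΓ⟩ := covers_cons.1 hΓ
    obtain ⟨hΔ₁, hΔ₂⟩ := covers_add.1 hΔ
    obtain ⟨hΓ₁, hΓ₂⟩ := covers_add.1 hΓ
    exact .beta (.imp A B) h (ih₁ hθ (hΓ₁.weaken _) (hΔ₁.cons hA))
      (ih₂ hθ (hΓ₂.cons hB) (hΔ₂.weaken _))
  | impR _ ih =>
    obtain ⟨⟨_, ⟨A, B, rfl, hA, hB⟩, h⟩, hΔ⟩ := covers_cons.1 hΔ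
    exact .alpha (.imp A B) h (ih hθ ((hΓ.weaken _).cons hA) ((hΔ.cons hB).weaken _))
  | allL t _ ih =>
    obtain ⟨⟨_, ⟨A, rfl, hA⟩, h⟩, hΓ⟩ := covers_cons.1 hΓ
    exact .gamma (θ t) (.all A) h (ih hθ (hΓ.cons (hA.inst rfl)) (hΔ.weaken _))
  | exR t _ ih =>
    obtain ⟨⟨_, ⟨A, rfl, hA⟩, h⟩, hΔ⟩ := covers_cons.1 hΔ
    exact .gamma (θ t) (.ex A) h (ih hθ (hΓ.weaken _) (hΔ.cons (hA.inst rfl)))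
  | allR a fΓ fΔ fA _ ih =>
    obtain ⟨⟨_, ⟨A, rfl, hA⟩, h⟩, hΔ⟩ := covers_cons.1 hΔ
    -- For every `t` the same induction hypothesis is used, with the eigenvariable sent to `t`. Its
    -- freshness is what keeps the images of the side formulas unchanged.
    exact .delta (.all A) h fun t => ih (hθ.extend a t) ((hΓ.extend fΓ t).weaken _)
      ((hΔ.extend fΔ t).cons ((hA.extend t fA).inst (Tm.extend_self θ a t).symm))
  | exL a fΓ fΔ fA _ ih =>
    obtain ⟨⟨_, ⟨A, rfl, hA⟩, h⟩, hΓ⟩ := covers_cons.1 hΓ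
    exact .delta (.ex A) h fun t => ih (hθ.extend a t)
      ((hΓ.extend fΓ t).cons ((hA.extend t fA).inst (Tm.extend_self θ a t).symm))
      ((hΔ.extend fΔ t).weaken _)

/-- The signature of all symbols. -/
def Sig.full (L : FirstOrder.Language.{u, v}) : Sig L := ⟨Set.univ, Set.univ⟩

theorem FmlRel.refl (A : Formula L) : FmlRel (Sig.full L) (graph id) A A :=
  FmlRel.self (Set.subset_univ _) (fun _ _ => Set.mem_univ _) (fun _ _ => Set.mem_univ _) _

theorem Provable.tab_of_subset (h : Provable Γ Δ) (hΓ : ∀ A ∈ Γ, (.first, A) ∈ X)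
    (hΔ : ∀ A ∈ Δ, (.second, A) ∈ X) : Tab X :=
  h.tab (isHom_id (Sig.full L)) (fun A hA => ⟨A, FmlRel.refl A, hΓ A hA⟩)
    fun A hA => ⟨A, FmlRel.refl A, hΔ A hA⟩

end LK

/-! ## The action of the basic operators -/

namespace Interp

variable {P : Type w}

namespace StructuredSet

@[simp] theorem single_self (i : Side) (s : P) : single i s i = {s} := by simp [single]

@[simp] theorem single_first_second (s : P) : single .first s .second = 0 := by simp [single]

@[simp] theorem single_second_first (s : P) : single .second s .first = 0 := by simp [single]

theorem mem_single {i j : Side} {s t : P} : t ∈ single i s j ↔ i = j ∧ t = s := by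
  cases i <;> cases j <;> simp

theorem exists_eq_add_single {S : StructuredSet P} {i : Side} {s : P} (h : s ∈ S i) :
    ∃ C : StructuredSet P, S = C + single i s := by
  obtain ⟨t, ht⟩ := Multiset.exists_cons_of_mem h
  refine ⟨Function.update S i t, ?_⟩
  funext j
  by_cases hj : j = i
  · subst hj
    simp [ht, ← Multiset.singleton_add, add_comm]
  · have : single i s j = 0 := by simp [single, hj]
    simp [hj, this]

end StructuredSet

open StructuredSet

variable [HasPoints P]

open Classical in
/-- The arguments that the instance `p` takes in the structured set number `i`. -/
noncomputable def Operator.argsIn (o : Operator P) (p : o.Inst) (i : o.Input) : StructuredSet P :=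
  ∑ a ∈ Finset.univ.filter (fun a => o.input a = i), single (o.side a) (o.arg p a).src

theorem Operator.argsIn_ofOne {s t : Side} {Inst : Type w} {value : Inst → P}
    {arg : (p : Inst) → Link (value p)} {h : ∀ p, (arg p).IsEmbedding}
    {app : Inst → StructuredSet P → Prop} (p : Inst) (i : Unit) :
    (Operator.ofOne s t Inst value arg h app).argsIn p i = single s (arg p).src := by
  unfold Operator.argsIn
  rw [Finset.sum_filter]
  exact (Fintype.sum_unique (ι := Unit) _).trans (if_pos rfl)

theorem Operator.argsIn_ofTwo {s₁ s₂ t : Side} {Inst : Type w} {value : Inst → P}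
    {arg₁ arg₂ : (p : Inst) → Link (value p)} {h₁ : ∀ p, (arg₁ p).IsEmbedding}
    {h₂ : ∀ p, (arg₂ p).IsEmbedding} (p : Inst) (i : Unit) :
    (Operator.ofTwo s₁ s₂ t Inst value arg₁ arg₂ h₁ h₂).argsIn p i =
      single s₁ (arg₁ p).src + single s₂ (arg₂ p).src := by
  unfold Operator.argsIn
  rw [Finset.sum_filter]
  exact (Fintype.sum_bool _).trans
    ((congrArg₂ (· + ·) (if_pos rfl) (if_pos rfl)).trans (add_comm _ _))

theorem Operator.argsIn_ofPair {s₁ s₂ t : Side} {Inst : Type w} {value : Inst → P}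
    {arg₁ arg₂ : (p : Inst) → Link (value p)} {h₁ : ∀ p, (arg₁ p).IsEmbedding}
    {h₂ : ∀ p, (arg₂ p).IsEmbedding} (p : Inst) (i : Bool) :
    (Operator.ofPair s₁ s₂ t Inst value arg₁ arg₂ h₁ h₂).argsIn p i =
      bif i then single s₂ (arg₂ p).src else single s₁ (arg₁ p).src := by
  unfold Operator.argsIn
  rw [Finset.sum_filter]
  refine (Fintype.sum_bool _).trans ?_
  cases i
  · exact (congrArg₂ (· + ·) (if_neg Bool.true_eq_false.mp) (if_pos rfl)).trans (zero_add _)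
  · exact (congrArg₂ (· + ·) (if_pos rfl) (if_neg Bool.false_eq_true.mp)).trans (add_zero _)

/-- This and the two analogues below turn the sums over inputs and arguments into explicit schemes
of inference, with side formulas `C`. -/
theorem Operator.ofOne_acts {s t : Side} {Inst : Type w} {value : Inst → P}
    {arg : (p : Inst) → Link (value p)} {h : ∀ p, (arg p).IsEmbedding}
    {app : Inst → StructuredSet P → Prop} {p : Inst} {S : Unit → StructuredSet P}
    {S₀ : StructuredSet P} :
    (Operator.ofOne s t Inst value arg h app).Acts p S S₀ ↔
      ∃ C, app p C ∧ S () = C + single s (arg p).src ∧ S₀ = C + single t (value p) := by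
  constructor
  · rintro ⟨C, hC, hS, h₀⟩
    refine ⟨C (), hC, (hS ()).trans (congrArg (C () + ·) (Operator.argsIn_ofOne p ())), ?_⟩
    exact h₀.trans (congrArg (· + _) (Fintype.sum_unique (ι := Unit) C))
  · rintro ⟨C, hC, hS, h₀⟩
    refine ⟨fun _ => C, hC, fun _ =>
      hS.trans (congrArg (C + ·) (Operator.argsIn_ofOne (h := h) (app := app) p ()).symm), ?_⟩
    exact h₀.trans (congrArg (· + _) (Fintype.sum_unique (ι := Unit) fun _ => C).symm)

theorem Operator.ofTwo_acts {s₁ s₂ t : Side} {Inst : Type w} {value : Inst → P}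
    {arg₁ arg₂ : (p : Inst) → Link (value p)} {h₁ : ∀ p, (arg₁ p).IsEmbedding}
    {h₂ : ∀ p, (arg₂ p).IsEmbedding} {p : Inst} {S : Unit → StructuredSet P}
    {S₀ : StructuredSet P} :
    (Operator.ofTwo s₁ s₂ t Inst value arg₁ arg₂ h₁ h₂).Acts p S S₀ ↔
      ∃ C, S () = C + (single s₁ (arg₁ p).src + single s₂ (arg₂ p).src) ∧
        S₀ = C + single t (value p) := by
  constructor
  · rintro ⟨C, -, hS, h₀⟩
    refine ⟨C (), (hS ()).trans (congrArg (C () + ·) (Operator.argsIn_ofTwo p ())), ?_⟩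
    exact h₀.trans (congrArg (· + _) (Fintype.sum_unique (ι := Unit) C))
  · rintro ⟨C, hS, h₀⟩
    refine ⟨fun _ => C, trivial, fun _ =>
      hS.trans (congrArg (C + ·) (Operator.argsIn_ofTwo (t := t) (h₁ := h₁) (h₂ := h₂) p ()).symm),
      ?_⟩
    exact h₀.trans (congrArg (· + _) (Fintype.sum_unique (ι := Unit) fun _ => C).symm)

theorem Operator.ofPair_acts {s₁ s₂ t : Side} {Inst : Type w} {value : Inst → P}
    {arg₁ arg₂ : (p : Inst) → Link (value p)} {h₁ : ∀ p, (arg₁ p).IsEmbedding}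
    {h₂ : ∀ p, (arg₂ p).IsEmbedding} {p : Inst} {S : Bool → StructuredSet P}
    {S₀ : StructuredSet P} :
    (Operator.ofPair s₁ s₂ t Inst value arg₁ arg₂ h₁ h₂).Acts p S S₀ ↔
      ∃ C₁ C₂, S false = C₁ + single s₁ (arg₁ p).src ∧ S true = C₂ + single s₂ (arg₂ p).src ∧
        S₀ = C₁ + C₂ + single t (value p) := by
  constructor
  · rintro ⟨C, -, hS, h₀⟩
    refine ⟨C false, C true,
      (hS false).trans (congrArg (C false + ·) (Operator.argsIn_ofPair p false)),
      (hS true).trans (congrArg (C true + ·) (Operator.argsIn_ofPair p true)), ?_⟩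
    exact h₀.trans (congrArg (· + _) ((Fintype.sum_bool C).trans (add_comm _ _)))
  · rintro ⟨C₁, C₂, hS₁, hS₂, h₀⟩
    refine ⟨fun b => bif b then C₂ else C₁, trivial, fun b => ?_, ?_⟩
    · have e := Operator.argsIn_ofPair (s₁ := s₁) (s₂ := s₂) (t := t) (h₁ := h₁) (h₂ := h₂) p b
      cases b
      · exact hS₁.trans (congrArg (C₁ + ·) e.symm)
      · exact hS₂.trans (congrArg (C₂ + ·) e.symm)
    · refine h₀.trans (congrArg (· + _) ?_)
      exact (add_comm _ _).trans (Fintype.sum_bool fun b => bif b then C₂ else C₁).symm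

end Interp

/-! ## Provable sequents are those generated by the operators -/

namespace LK

open Interp Interp.StructuredSet FirstOrder.Language

variable {L : FirstOrder.Language.{u, v}}

/-- The structured sets generated from initial sequents by the operators of LK. -/
abbrev Gen (S : StructuredSet (Formula L)) : Prop := Generated (operators L) (initial L) S

/-- The structured set consisting of one signed formula. -/
abbrev SFml.single (φ : SFml L) : StructuredSet (Formula L) := StructuredSet.single φ.1 φ.2

variable {C C₁ C₂ S : StructuredSet (Formula L)}

theorem Gen.contr {φ : SFml L} (h : Gen (C + (φ.single + φ.single))) : Gen (C + φ.single) := by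
  obtain ⟨i, A⟩ := φ
  refine Generated.step (o := contrOp i) ?_ A (S := fun _ => _) (fun _ => h)
    (Operator.ofTwo_acts.2 ⟨C, rfl, rfl⟩)
  cases i <;> simp [operators]

theorem Gen.alpha {φ φ₁ φ₂ : SFml L} (hφ : Alpha φ φ₁ φ₂)
    (h : Gen (C + (φ₁.single + φ₂.single))) : Gen (C + φ.single) := by
  cases hφ with
  | neg i A =>
    -- The two components of a negation are the same signed formula, so they are contracted before
    -- the rule for negation is applied.
    refine Generated.step (o := negOp i.opp) ?_ A (S := fun _ => _) (fun _ => Gen.contr h)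
      (Operator.ofOne_acts.2 ⟨C, trivial, rfl, ?_⟩)
    · cases i <;> simp [operators, Side.opp]
    · cases i <;> rfl
  | and A B =>
    exact Generated.step (o := andLOp) (by simp [operators]) (A, B) (S := fun _ => _) (fun _ => h)
      (Operator.ofTwo_acts.2 ⟨C, rfl, rfl⟩)
  | or A B =>
    exact Generated.step (o := orROp) (by simp [operators]) (A, B) (S := fun _ => _) (fun _ => h)
      (Operator.ofTwo_acts.2 ⟨C, rfl, rfl⟩)
  | imp A B =>
    exact Generated.step (o := impROp) (by simp [operators]) (A, B) (S := fun _ => _) (fun _ => h)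
      (Operator.ofTwo_acts.2 ⟨C, rfl, rfl⟩)

theorem Gen.beta {φ φ₁ φ₂ : SFml L} (hφ : Beta φ φ₁ φ₂) (h₁ : Gen (C₁ + φ₁.single))
    (h₂ : Gen (C₂ + φ₂.single)) : Gen (C₁ + C₂ + φ.single) := by
  cases hφ with
  | and A B =>
    exact Generated.step (o := andROp) (by simp [operators]) (A, B)
      (S := fun b => bif b then _ else _) (fun b => by cases b; exacts [h₁, h₂])
      (Operator.ofPair_acts.2 ⟨C₁, C₂, rfl, rfl, rfl⟩)
  | or A B =>
    exact Generated.step (o := orLOp) (by simp [operators]) (A, B)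
      (S := fun b => bif b then _ else _) (fun b => by cases b; exacts [h₁, h₂])
      (Operator.ofPair_acts.2 ⟨C₁, C₂, rfl, rfl, rfl⟩)
  | imp A B =>
    exact Generated.step (o := impLOp) (by simp [operators]) (A, B)
      (S := fun b => bif b then _ else _) (fun b => by cases b; exacts [h₁, h₂])
      (Operator.ofPair_acts.2 ⟨C₁, C₂, rfl, rfl, rfl⟩)

theorem Gen.gamma {φ : SFml L} {A : Fml L 1} (hφ : Gamma φ A) (t : Tm L 0)
    (h : Gen (C + SFml.single (φ.1, A.inst t))) : Gen (C + φ.single) := by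
  cases hφ with
  | all =>
    exact Generated.step (o := allLOp) (by simp [operators]) (A, t) (S := fun _ => _) (fun _ => h)
      (Operator.ofOne_acts.2 ⟨C, trivial, rfl, rfl⟩)
  | ex =>
    exact Generated.step (o := exROp) (by simp [operators]) (A, t) (S := fun _ => _) (fun _ => h)
      (Operator.ofOne_acts.2 ⟨C, trivial, rfl, rfl⟩)

theorem Gen.delta {φ : SFml L} {A : Fml L 1} (hφ : Delta φ A) {a : ℕ} (hA : a ∉ A.freeVars)
    (hC : ∀ i, Fresh a (C i)) (h : Gen (C + SFml.single (φ.1, A.inst (freeVar a)))) :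
    Gen (C + φ.single) := by
  cases hφ with
  | all =>
    exact Generated.step (o := allROp) (by simp [operators]) ⟨(A, a), hA⟩ (S := fun _ => _)
      (fun _ => h) (Operator.ofOne_acts.2 ⟨C, hC, rfl, rfl⟩)
  | ex =>
    exact Generated.step (o := exLOp) (by simp [operators]) ⟨(A, a), hA⟩ (S := fun _ => _)
      (fun _ => h) (Operator.ofOne_acts.2 ⟨C, hC, rfl, rfl⟩)

theorem Gen.contr_of_mem {φ : SFml L} (hφ : φ.2 ∈ S φ.1) (h : Gen (S + φ.single)) : Gen S := by
  obtain ⟨C, rfl⟩ := exists_eq_add_single hφ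
  rw [add_assoc] at h
  exact Gen.contr h

/-- Superfluous copies are contracted one at a time, by induction on their number. -/
theorem Gen.contr_of_subset {E : StructuredSet (Formula L)} (hE : ∀ i, E i ⊆ S i)
    (h : Gen (S + E)) : Gen S := by
  induction hn : (E .first).card + (E .second).card generalizing E with
  | zero =>
    have hE0 : E = 0 := by
      funext i
      cases i
      · exact Multiset.card_eq_zero.1 (by omega)
      · exact Multiset.card_eq_zero.1 (by omega)
    rwa [hE0, add_zero] at h
  | succ n ih =>
    have : ∃ i A, A ∈ E i := by
      by_contra! hc
      have h₁ := Multiset.eq_zero_of_forall_notMem (hc .first)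
      have h₂ := Multiset.eq_zero_of_forall_notMem (hc .second)
      rw [h₁, h₂] at hn
      simp at hn
    obtain ⟨i, A, hA⟩ := this
    obtain ⟨E', rfl⟩ := exists_eq_add_single hA
    refine ih (E := E') (fun j B hB => hE j (Multiset.mem_add.2 (Or.inl hB))) ?_ ?_
    · rw [← add_assoc] at h
      exact Gen.contr_of_mem (φ := (i, A)) (Multiset.mem_add.2 (Or.inl (hE i hA))) h
    · cases i <;> simp at hn <;> omega

theorem exists_fresh (A : Fml L 1) (S : StructuredSet (Formula L)) :
    ∃ a, a ∉ A.freeVars ∧ ∀ i, Fresh a (S i) := by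
  have hfin : ∀ Γ : Multiset (Formula L), {a | ¬ Fresh a Γ}.Finite := fun Γ => by
    classical
    refine (Set.Finite.biUnion Γ.toFinset.finite_toSet fun C _ => C.finite_freeVars).subset ?_
    intro a ha
    simpa [Fresh] using ha
  obtain ⟨a, ha⟩ := (A.finite_freeVars.union
    ((hfin (S .first)).union (hfin (S .second)))).exists_notMem
  simp only [Set.mem_union, Set.mem_ofPred_eq, not_or, not_not] at ha
  exact ⟨a, ha.1, fun i => by cases i; exacts [ha.2.1, ha.2.2]⟩

/-- Every rule is applied with the whole of `S` as side formulas. The principal formula, produced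
once more, is contracted with its copy in `S`. -/
theorem Tab.gen {X : List (SFml L)} (h : Tab X) (hX : ∀ φ ∈ X, φ.2 ∈ S φ.1) : Gen S := by
  have add : ∀ {S : StructuredSet (Formula L)} {X : List (SFml L)} (φ : SFml L),
      (∀ ψ ∈ X, ψ.2 ∈ S ψ.1) → ∀ ψ ∈ φ :: X, ψ.2 ∈ (S + φ.single) ψ.1 := by
    intro S X φ hX ψ hψ
    rcases List.mem_cons.1 hψ with rfl | hψ
    · exact Multiset.mem_add.2 (Or.inr (mem_single.2 ⟨rfl, rfl⟩))
    · exact Multiset.mem_add.2 (Or.inl (hX ψ hψ))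
  induction h generalizing S with
  | ax A h₁ h₂ => exact .base (Or.inl ⟨A, hX _ h₁, hX _ h₂⟩)
  | top h => exact .base (Or.inr (Or.inl (hX _ h)))
  | bot h => exact .base (Or.inr (Or.inr (hX _ h)))
  | @alpha X φ φ₁ φ₂ hφ hmem _ ih =>
    refine Gen.contr_of_mem (hX φ hmem) (Gen.alpha hφ ?_)
    rw [add_comm φ₁.single, ← add_assoc]
    exact ih (add _ (add _ hX))
  | @beta X φ φ₁ φ₂ hφ hmem _ _ ih₁ ih₂ =>
    -- Two-premise operators add up the side formulas, so `S` appears twice and one copy of it is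
    -- contracted away.
    refine Gen.contr_of_subset (fun _ _ => id) (Gen.contr_of_mem (φ := φ) ?_
      (Gen.beta hφ (ih₁ (add _ hX)) (ih₂ (add _ hX))))
    exact Multiset.mem_add.2 (Or.inl (hX φ hmem))
  | @gamma X φ A t hφ hmem _ ih =>
    exact Gen.contr_of_mem (hX φ hmem) (Gen.gamma hφ t (ih (add _ hX)))
  | @delta X φ A hφ hmem _ ih =>
    -- Of the premises for all closed terms only the one for a fresh variable is used; freshness for
    -- `S` is the applicability requirement.
    obtain ⟨a, ha, haS⟩ := exists_fresh A S
    exact Gen.contr_of_mem (hX φ hmem) (Gen.delta hφ ha haS (ih _ (add _ hX)))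

/-! ### From generated structured sets back to LK -/

/-- The sequent that corresponds to the structured set is provable. -/
abbrev ProvableSet (S : StructuredSet (Formula L)) : Prop := Provable (S .first) (S .second)

section

variable {A B : Formula L}

theorem provableSet_first : ProvableSet (C + StructuredSet.single .first A) ↔
    Provable (A ::ₘ C .first) (C .second) := by
  simp [ProvableSet, ← Multiset.singleton_add, add_comm]

theorem provableSet_second : ProvableSet (C + StructuredSet.single .second A) ↔
    Provable (C .first) (A ::ₘ C .second) := by
  simp [ProvableSet, ← Multiset.singleton_add, add_comm]

theorem provableSet_first_first :
    ProvableSet (C + (StructuredSet.single .first A + StructuredSet.single .first B)) ↔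
      Provable (A ::ₘ B ::ₘ C .first) (C .second) := by
  simp [ProvableSet, ← Multiset.singleton_add, add_comm, add_left_comm]

theorem provableSet_first_second :
    ProvableSet (C + (StructuredSet.single .first A + StructuredSet.single .second B)) ↔
      Provable (A ::ₘ C .first) (B ::ₘ C .second) := by
  simp [ProvableSet, ← Multiset.singleton_add, add_comm]

theorem provableSet_second_second :
    ProvableSet (C + (StructuredSet.single .second A + StructuredSet.single .second B)) ↔
      Provable (C .first) (A ::ₘ B ::ₘ C .second) := by
  simp [ProvableSet, ← Multiset.singleton_add, add_comm, add_left_comm]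

end

theorem Gen.provable (h : Gen S) : ProvableSet S := by
  induction h with
  | @base S h =>
    rcases h with ⟨A, h₁, h₂⟩ | h | h
    · obtain ⟨Γ, hΓ⟩ := Multiset.exists_cons_of_mem h₁
      obtain ⟨Δ, hΔ⟩ := Multiset.exists_cons_of_mem h₂
      rw [ProvableSet, hΓ, hΔ]
      exact .ax A Γ Δ
    · obtain ⟨Δ, hΔ⟩ := Multiset.exists_cons_of_mem h
      rw [ProvableSet, hΔ]
      exact .topR _ Δ
    · obtain ⟨Γ, hΓ⟩ := Multiset.exists_cons_of_mem h
      rw [ProvableSet, hΓ]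
      exact .botL Γ _
  | @step o ho p S S₀ _ hact ih =>
    rcases ho with rfl | rfl | rfl | rfl | rfl | rfl | rfl | rfl | rfl | rfl | rfl | rfl | rfl | rfl
    · obtain ⟨C, hS, rfl⟩ := Operator.ofTwo_acts.1 hact
      exact provableSet_first.2 (.contrL (provableSet_first_first.1 (hS ▸ ih ())))
    · obtain ⟨C, hS, rfl⟩ := Operator.ofTwo_acts.1 hact
      exact provableSet_second.2 (.contrR (provableSet_second_second.1 (hS ▸ ih ())))
    · obtain ⟨C, -, hS, rfl⟩ := Operator.ofOne_acts.1 hact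
      exact provableSet_second.2 (.negR (provableSet_first.1 (hS ▸ ih ())))
    · obtain ⟨C, -, hS, rfl⟩ := Operator.ofOne_acts.1 hact
      exact provableSet_first.2 (.negL (provableSet_second.1 (hS ▸ ih ())))
    · obtain ⟨C, hS, rfl⟩ := Operator.ofTwo_acts.1 hact
      exact provableSet_first.2 (.andL (provableSet_first_first.1 (hS ▸ ih ())))
    · obtain ⟨C₁, C₂, h₁, h₂, rfl⟩ := Operator.ofPair_acts.1 hact
      exact provableSet_second.2 (.andR (provableSet_second.1 (h₁ ▸ ih false))
        (provableSet_second.1 (h₂ ▸ ih true)))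
    · obtain ⟨C₁, C₂, h₁, h₂, rfl⟩ := Operator.ofPair_acts.1 hact
      exact provableSet_first.2 (.orL (provableSet_first.1 (h₁ ▸ ih false))
        (provableSet_first.1 (h₂ ▸ ih true)))
    · obtain ⟨C, hS, rfl⟩ := Operator.ofTwo_acts.1 hact
      exact provableSet_second.2 (.orR (provableSet_second_second.1 (hS ▸ ih ())))
    · obtain ⟨C₁, C₂, h₁, h₂, rfl⟩ := Operator.ofPair_acts.1 hact
      exact provableSet_first.2 (.impL (provableSet_second.1 (h₁ ▸ ih false))
        (provableSet_first.1 (h₂ ▸ ih true)))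
    · obtain ⟨C, hS, rfl⟩ := Operator.ofTwo_acts.1 hact
      exact provableSet_second.2 (.impR (provableSet_first_second.1 (hS ▸ ih ())))
    · obtain ⟨C, -, hS, rfl⟩ := Operator.ofOne_acts.1 hact
      exact provableSet_first.2 (.allL p.2 (provableSet_first.1 (hS ▸ ih ())))
    · obtain ⟨C, hC, hS, rfl⟩ := Operator.ofOne_acts.1 hact
      exact provableSet_second.2 (.allR p.1.2 (hC _) (hC _) p.2
        (provableSet_second.1 (hS ▸ ih ())))
    · obtain ⟨C, hC, hS, rfl⟩ := Operator.ofOne_acts.1 hact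
      exact provableSet_first.2 (.exL p.1.2 (hC _) (hC _) p.2
        (provableSet_first.1 (hS ▸ ih ())))
    · obtain ⟨C, -, hS, rfl⟩ := Operator.ofOne_acts.1 hact
      exact provableSet_second.2 (.exR p.2 (provableSet_second.1 (hS ▸ ih ())))

theorem provable_iff_generated (Γ Δ : Multiset (Formula L)) :
    Provable Γ Δ ↔ Generated (operators L) (initial L) (sequent Γ Δ) := by
  refine ⟨fun h => ?_, fun h => Gen.provable h⟩
  have hX := h.tab_of_subset
    (X := Γ.toList.map (Prod.mk Side.first) ++ Δ.toList.map (Prod.mk Side.second))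
    (fun A hA => by simpa using hA) (fun A hA => by simpa using hA)
  refine hX.gen fun φ hφ => ?_
  simp only [List.mem_append, List.mem_map, Multiset.mem_toList] at hφ
  rcases hφ with ⟨A, hA, rfl⟩ | ⟨A, hA, rfl⟩ <;> exact hA

/-- Contradictory signed formulas make up a provable sequent. -/
theorem Tab.provable {X : List (SFml L)} (h : Tab X) {Γ Δ : Multiset (Formula L)}
    (hX : ∀ φ ∈ X, φ.2 ∈ sequent Γ Δ φ.1) : Provable Γ Δ :=
  Gen.provable (h.gen hX)

/-- A round trip: the list is turned into an LK proof, which is translated back along θ. In this way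
replacement in tableaux needs no induction of its own. -/
theorem Tab.map {X Y : List (SFml L)} (h : Tab X) {S : Sig L} {θ : Tm L 0 → Tm L 0}
    (hθ : IsHom S θ) (hXY : ∀ φ ∈ X, ∃ A, FmlRel S (graph θ) φ.2 A ∧ (φ.1, A) ∈ Y) : Tab Y := by
  classical
  refine (h.provable (Γ := ↑((X.filter (·.1 = .first)).map Prod.snd))
    (Δ := ↑((X.filter (·.1 = .second)).map Prod.snd)) ?_).tab hθ ?_ ?_
  · rintro ⟨i | i, A⟩ hA <;> simpa [sequent] using hA
  · intro A hA
    obtain ⟨φ, hφ, rfl⟩ := List.mem_map.1 (Multiset.mem_coe.1 hA)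
    obtain ⟨hφ, hi⟩ := List.mem_filter.1 hφ
    simpa [of_decide_eq_true hi] using hXY φ hφ
  · intro A hA
    obtain ⟨φ, hφ, rfl⟩ := List.mem_map.1 (Multiset.mem_coe.1 hA)
    obtain ⟨hφ, hi⟩ := List.mem_filter.1 hφ
    simpa [of_decide_eq_true hi] using hXY φ hφ

end LK

/-! ## Interpolation -/

namespace LK

open Interp Interp.StructuredSet FirstOrder.Language

variable {L : FirstOrder.Language.{u, v}} {S S₁ S₂ : Sig L} {U U₁ U₂ : Set (Tm L 0)}
  {X X₁ X₂ : List (SFml L)}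

/-- The signed formulas are built from the symbols of `S`, with finitely many free variables, and
from finitely many closed terms. -/
structure OverList (S : Sig L) (U : Set (Tm L 0)) (X : List (SFml L)) : Prop where
  finite_vars : {a | Sum.inl a ∈ S.syms}.Finite
  finite : U.Finite
  subtermClosed : SubtermClosed U
  mem_over : ∀ φ ∈ X, Over S U φ.2

theorem OverList.cons (h : OverList S U X) {φ : SFml L} (hφ : Over S U φ.2) :
    OverList S U (φ :: X) :=
  ⟨h.finite_vars, h.finite, h.subtermClosed, List.forall_mem_cons.2 ⟨hφ, h.mem_over⟩⟩

/-- The signature is not enlarged: all subterms of the instantiating term become parameters, even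
those built from symbols of `S`. -/
theorem OverList.cons_inst (h : OverList S U X) {A : Fml L 1} (hA : Over S U A) (i : Side)
    (t : Tm L 0) : OverList S (U ∪ t.subterms) ((i, A.inst t) :: X) where
  finite_vars := h.finite_vars
  finite := h.finite.union t.finite_subterms
  subtermClosed := h.subtermClosed.union (subtermClosed_subterms t)
  mem_over := List.forall_mem_cons.2
    ⟨(hA.mono Set.subset_union_left).inst (Or.inr t.self_mem_subterms),
      fun φ hφ => (h.mem_over φ hφ).mono Set.subset_union_left⟩

theorem Alpha.over {φ φ₁ φ₂ : SFml L} (h : Alpha φ φ₁ φ₂) (hφ : Over S U φ.2) :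
    Over S U φ₁.2 ∧ Over S U φ₂.2 := by
  cases h with
  | neg i A => exact ⟨over_neg.1 hφ, over_neg.1 hφ⟩
  | and A B => exact over_and.1 hφ
  | or A B => exact over_or.1 hφ
  | imp A B => exact over_imp.1 hφ

theorem Beta.over {φ φ₁ φ₂ : SFml L} (h : Beta φ φ₁ φ₂) (hφ : Over S U φ.2) :
    Over S U φ₁.2 ∧ Over S U φ₂.2 := by
  cases h with
  | and A B => exact over_and.1 hφ
  | or A B => exact over_or.1 hφ
  | imp A B => exact over_imp.1 hφ

theorem Gamma.over {φ : SFml L} {A : Fml L 1} (h : Gamma φ A) : Over S U φ.2 ↔ Over S U A := by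
  cases h with
  | all => exact over_all
  | ex => exact over_ex

theorem Delta.over {φ : SFml L} {A : Fml L 1} (h : Delta φ A) : Over S U φ.2 ↔ Over S U A := by
  cases h with
  | all => exact over_all
  | ex => exact over_ex

theorem Over.fmlRel_replace {n : ℕ} {A : Fml L n} (h : Over S U A) {d : Tm L 0}
    (hd : ∀ s ∈ U, d ∉ s.subterms) (t : Tm L 0) : FmlRel S (graph (Tm.replace d t)) A A :=
  h.fmlRel fun s hs => (Tm.replace_of_notMem (hd s hs)).symm

theorem Over.left {n : ℕ} {A : Fml L n} (h : Over (S₁.inter S₂) U A) : Over S₁ U A :=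
  FmlRel.mono Set.inter_subset_left Set.inter_subset_left (fun _ _ => id) h

theorem Over.right {n : ℕ} {A : Fml L n} (h : Over (S₁.inter S₂) U A) : Over S₂ U A :=
  FmlRel.mono Set.inter_subset_right Set.inter_subset_right (fun _ _ => id) h

theorem SubtermClosed.notMem_subterms (hU : SubtermClosed U) {d : Tm L 0} (hd : d ∉ U) :
    ∀ s ∈ U, d ∉ s.subterms := fun s hs h => hd (hU s hs h)

/-- A closed term that begins with a foreign symbol and occurs in `K.inst d` only for the bound
variable can be generalized. -/
theorem Tab.generalize {V : Set (Tm L 0)} {φ : SFml L} {K : Fml L 1} {d : Tm L 0} (hφ : Delta φ K)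
    (hd : d.head ∉ S.syms) (hdU : d ∉ U) (hX : OverList S U X) (hK : Over S V K)
    (hV : ∀ s ∈ V, d ∉ s.subterms) (h : Tab ((φ.1, K.inst d) :: X)) : Tab (φ :: X) := by
  refine .delta hφ List.mem_cons_self fun t => h.map (isHom_replace t hd) ?_
  intro ψ hψ
  rcases List.mem_cons.1 hψ with rfl | hψ
  · exact ⟨K.inst t, (hK.fmlRel_replace hV t).inst (Tm.replace_self d t).symm, by simp⟩
  · exact ⟨ψ.2, (hX.mem_over ψ hψ).fmlRel_replace (hX.subtermClosed.notMem_subterms hdU) t,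
      by simp [hψ]⟩

/-! ### Interpolants of partitioned lists -/

/-- An interpolant for the partition of a contradictory list of signed formulas into `X₁` and `X₂`,
which are over `S₁`, `U₁` and over `S₂`, `U₂`.  Its alien terms are subterms of alien terms that
occur in `X₁` or `X₂`. -/
def HasInterpolant (S₁ S₂ : Sig L) (U₁ U₂ : Set (Tm L 0)) (X₁ X₂ : List (SFml L)) : Prop :=
  ∃ (U : Finset (Tm L 0)) (J : Formula L), Over (S₁.inter S₂) ↑U J ∧
    (∀ s ∈ U, Alien S₁ S₂ s) ∧ (∀ s ∈ U, ∃ d ∈ U, s ∈ d.subterms ∧ Anchored S₁ S₂ U₁ U₂ d) ∧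
    Tab ((.second, J) :: X₁) ∧ Tab ((.first, J) :: X₂)

/-- Negating the interpolant exchanges the two halves. Each tableau rule therefore needs to be
treated only when its principal formula is in the first half. -/
theorem HasInterpolant.symm (h : HasInterpolant S₁ S₂ U₁ U₂ X₁ X₂) :
    HasInterpolant S₂ S₁ U₂ U₁ X₂ X₁ := by
  obtain ⟨U, J, hJ, hU, hU', h₁, h₂⟩ := h
  refine ⟨U, .neg J, over_neg.2 ?_, fun s hs => (hU s hs).symm, fun s hs => ?_, ?_, ?_⟩
  · rwa [Sig.inter, Set.inter_comm, Set.inter_comm S₂.syms]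
  · obtain ⟨d, hd, hsd, hd'⟩ := hU' s hs
    exact ⟨d, hd, hsd, hd'.2, hd'.1⟩
  · exact .alpha (.neg _ J) List.mem_cons_self
      (h₂.mono (by simp +contextual [Side.opp, List.subset_def]))
  · exact .alpha (.neg _ J) List.mem_cons_self
      (h₁.mono (by simp +contextual [Side.opp, List.subset_def]))

/-- Restores the invariant on alien terms: those not contained in an anchored one are removed from
the interpolant by quantification, by induction on the set of alien terms. -/
theorem HasInterpolant.of_alien (hX₁ : OverList S₁ U₁ X₁) (hX₂ : OverList S₂ U₂ X₂)
    {U : Finset (Tm L 0)} {J : Formula L} (hJ : Over (S₁.inter S₂) ↑U J)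
    (hU : ∀ s ∈ U, Alien S₁ S₂ s) (h₁ : Tab ((.second, J) :: X₁)) (h₂ : Tab ((.first, J) :: X₂)) :
    HasInterpolant S₁ S₂ U₁ U₂ X₁ X₂ := by
  classical
  induction U using Finset.strongInduction generalizing J with
  | H U ih =>
    by_cases hbad : ∀ s ∈ U, ∃ d ∈ U, s ∈ d.subterms ∧ Anchored S₁ S₂ U₁ U₂ d
    · exact ⟨U, J, hJ, hU, hbad, h₁, h₂⟩
    · push Not at hbad
      obtain ⟨s, hs, hbad⟩ := hbad
      -- A bad term of maximal size is not a proper subterm of any alien term in `U`: a larger term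
      -- containing it would be bad as well. Hence abstracting from `d` leaves no occurrence of `d`
      -- behind.
      obtain ⟨d, hd, hmax⟩ := Finset.exists_max_image
        (U.filter fun s => ∀ d ∈ U, s ∈ d.subterms → ¬ Anchored S₁ S₂ U₁ U₂ d) Tm.size
        ⟨s, Finset.mem_filter.2 ⟨hs, hbad⟩⟩
      obtain ⟨hdU, hd⟩ := Finset.mem_filter.1 hd
      have hsub : ∀ s ∈ (↑(U.erase d) : Set (Tm L 0)), d ∉ s.subterms := by
        intro s hs hds
        obtain ⟨hne, hs⟩ := Finset.mem_erase.1 (Finset.mem_coe.1 hs)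
        exact absurd (Tm.size_lt_of_mem_subterms hds (Ne.symm hne)) (not_lt.2 (hmax s
          (Finset.mem_filter.2 ⟨hs, fun e he hse => hd e he (Tm.subterms_subset hse hds)⟩)))
      rw [← Finset.insert_erase hdU, Finset.coe_insert] at hJ
      obtain ⟨K, hK, rfl⟩ := hJ.exists_inst_eq
      have hd' := hd d hdU d.self_mem_subterms
      have hU' : ∀ s ∈ U.erase d, Alien S₁ S₂ s := fun s hs => hU s (Finset.mem_of_mem_erase hs)
      -- `d` itself is not anchored. If it is foreign to `X₁`, then ∀ is a generalization for `X₁`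
      -- and an instantiation by `d` for `X₂`; if it is foreign to `X₂`, then ∃ works with the roles
      -- exchanged.
      rcases not_and_or.1 hd' with hd' | hd'
      · obtain ⟨hhd, hdU₁⟩ := Classical.not_imp.1 hd'
        exact ih _ (Finset.erase_ssubset hdU) (J := .all K) (over_all.2 hK) hU'
          (h₁.generalize (φ := (.second, .all K)) (.all K) hhd hdU₁ hX₁ hK.left hsub)
          (.gamma d (.all K) List.mem_cons_self (h₂.mono (by simp)))
      · obtain ⟨hhd, hdU₂⟩ := Classical.not_imp.1 hd'
        exact ih _ (Finset.erase_ssubset hdU) (J := .ex K) (over_ex.2 hK) hU'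
          (.gamma d (.ex K) List.mem_cons_self (h₁.mono (by simp)))
          (h₂.generalize (φ := (.first, .ex K)) (.ex K) hhd hdU₂ hX₂ hK.right hsub)

/-- If the first half is contradictory by itself, ⊥ is an interpolant. -/
theorem HasInterpolant.of_tab (h : Tab X₁) : HasInterpolant S₁ S₂ U₁ U₂ X₁ X₂ :=
  ⟨∅, .bot, rfl, by simp, by simp, h.mono (by simp), .bot (by simp)⟩

/-- When the axiom formula is shared by the halves, it is its own interpolant. Read over both
signatures, its alien terms are anchored, and anchored alien terms lie in the finite set `U₁ ∪ U₂`.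
-/
theorem HasInterpolant.ax (hX₁ : OverList S₁ U₁ X₁) (hX₂ : OverList S₂ U₂ X₂) {A : Formula L}
    (h₁ : (.first, A) ∈ X₁) (h₂ : (.second, A) ∈ X₂) : HasInterpolant S₁ S₂ U₁ U₂ X₁ X₂ := by
  have hfin : {s | Alien S₁ S₂ s ∧ Anchored S₁ S₂ U₁ U₂ s}.Finite :=
    (hX₁.finite.union hX₂.finite).subset fun s hs => hs.1.imp hs.2.1 hs.2.2
  refine ⟨hfin.toFinset, A, ?_, fun s hs => (hfin.mem_toFinset.1 hs).1,
    fun s hs => ⟨s, hs, s.self_mem_subterms, (hfin.mem_toFinset.1 hs).2⟩,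
    .ax A (by simp [h₁]) (by simp), .ax A (by simp) (by simp [h₂])⟩
  rw [hfin.coe_toFinset]
  have o₁ : Over S₁ U₁ A := hX₁.mem_over _ h₁
  have o₂ : Over S₂ U₂ A := hX₂.mem_over _ h₂
  exact o₁.inter hX₁.subtermClosed hX₂.subtermClosed o₂

theorem HasInterpolant.alpha {φ φ₁ φ₂ : SFml L} (hφ : Alpha φ φ₁ φ₂) (hmem : φ ∈ X₁)
    (h : HasInterpolant S₁ S₂ U₁ U₂ (φ₁ :: φ₂ :: X₁) X₂) :
    HasInterpolant S₁ S₂ U₁ U₂ X₁ X₂ := by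
  obtain ⟨U, J, hJ, hU, hU', h₁, h₂⟩ := h
  exact ⟨U, J, hJ, hU, hU', .alpha hφ (List.mem_cons_of_mem _ hmem)
    (h₁.mono (by simp [List.subset_def]; tauto)), h₂⟩

/-- Branching in the first half takes the disjunction of the interpolants: for `X₁` both disjuncts
are available as false, while for `X₂` the disjunction is split. -/
theorem HasInterpolant.beta {φ φ₁ φ₂ : SFml L} (hφ : Beta φ φ₁ φ₂) (hmem : φ ∈ X₁)
    (h : HasInterpolant S₁ S₂ U₁ U₂ (φ₁ :: X₁) X₂)
    (h' : HasInterpolant S₁ S₂ U₁ U₂ (φ₂ :: X₁) X₂) :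
    HasInterpolant S₁ S₂ U₁ U₂ X₁ X₂ := by
  classical
  obtain ⟨U, J, hJ, hU, hU', h₁, h₂⟩ := h
  obtain ⟨V, K, hK, hV, hV', k₁, k₂⟩ := h'
  refine ⟨U ∪ V, .or J K, over_or.2 ⟨hJ.mono (by simp), hK.mono (by simp)⟩, ?_, ?_, ?_, ?_⟩
  · intro s hs
    exact (Finset.mem_union.1 hs).elim (hU s) (hV s)
  · intro s hs
    rcases Finset.mem_union.1 hs with hs | hs
    · obtain ⟨d, hd, h⟩ := hU' s hs
      exact ⟨d, Finset.mem_union_left _ hd, h⟩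
    · obtain ⟨d, hd, h⟩ := hV' s hs
      exact ⟨d, Finset.mem_union_right _ hd, h⟩
  · refine .alpha (.or J K) List.mem_cons_self (.beta hφ (by simp [hmem])
      (h₁.mono ?_) (k₁.mono ?_)) <;> simp [List.subset_def] <;> tauto
  · exact .beta (.or J K) List.mem_cons_self (h₂.mono (by simp)) (k₂.mono (by simp))

/-- The interpolant of the premise serves, except that its alien terms may be anchored only through
`t`. The anchoring is therefore discarded and re-established by `of_alien`. -/
theorem HasInterpolant.gamma (hX₁ : OverList S₁ U₁ X₁) (hX₂ : OverList S₂ U₂ X₂) {φ : SFml L}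
    {A : Fml L 1} (hφ : Gamma φ A) (hmem : φ ∈ X₁) {t : Tm L 0}
    (h : HasInterpolant S₁ S₂ (U₁ ∪ t.subterms) U₂ ((φ.1, A.inst t) :: X₁) X₂) :
    HasInterpolant S₁ S₂ U₁ U₂ X₁ X₂ := by
  obtain ⟨U, J, hJ, hU, -, h₁, h₂⟩ := h
  exact .of_alien hX₁ hX₂ hJ hU (.gamma t hφ (List.mem_cons_of_mem _ hmem)
    (h₁.mono (by simp [List.subset_def]; tauto))) h₂

/-- The interpolant of the premise is kept, as the fresh variable does not occur in its alien terms.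
Replacing that variable by an arbitrary term then supplies all premises of the existential rule. -/
theorem HasInterpolant.delta (hX₁ : OverList S₁ U₁ X₁) (hX₂ : OverList S₂ U₂ X₂) {φ : SFml L}
    {A : Fml L 1} (hφ : Delta φ A) (hmem : φ ∈ X₁) {a : ℕ} (ha₁ : Sum.inl a ∉ S₁.syms)
    (ha₂ : Sum.inl a ∉ S₂.syms) (haU₁ : freeVar a ∉ U₁) (haU₂ : freeVar a ∉ U₂)
    (h : HasInterpolant S₁ S₂ (U₁ ∪ (freeVar a).subterms) U₂
      ((φ.1, A.inst (freeVar a)) :: X₁) X₂) :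
    HasInterpolant S₁ S₂ U₁ U₂ X₁ X₂ := by
  obtain ⟨U, J, hJ, hU, hU', h₁, h₂⟩ := h
  -- An anchored alien term containing `a` cannot be in `U₂`, so its head is in `S₂` but not in
  -- `S₁`. It then lies in `U₁` or is `a` itself, and both are excluded by the choice of `a`.
  have hfresh : ∀ s ∈ (↑U : Set (Tm L 0)), freeVar a ∉ s.subterms := by
    intro s hs has
    obtain ⟨d, hd, hsd, hd₁, hd₂⟩ := hU' s hs
    have had := Tm.subterms_subset hsd has
    have hd₂' : d.head ∈ S₂.syms := by
      by_contra hc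
      exact haU₂ (hX₂.subtermClosed d (hd₂ hc) had)
    rcases hd₁ ((hU d hd).resolve_right (not_not.2 hd₂')) with hd | rfl
    · exact haU₁ (hX₁.subtermClosed d hd had)
    · exact ha₂ hd₂'
  refine ⟨U, J, hJ, hU, fun s hs => ?_, .delta hφ (List.mem_cons_of_mem _ hmem) fun t =>
    h₁.map (isHom_replace (d := freeVar a) t ha₁) fun ψ hψ => ?_, h₂⟩
  · obtain ⟨d, hd, hsd, hd₁, hd₂⟩ := hU' s hs
    refine ⟨d, hd, hsd, fun h => (hd₁ h).resolve_right ?_, hd₂⟩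
    rintro rfl
    exact hfresh _ hd (Tm.self_mem_subterms _)
  · rcases List.mem_cons.1 hψ with rfl | hψ
    · exact ⟨J, hJ.left.fmlRel_replace hfresh t, by simp⟩
    · have hsub := hX₁.subtermClosed.notMem_subterms haU₁
      rcases List.mem_cons.1 hψ with rfl | hψ
      · exact ⟨A.inst t, ((hφ.over.1 (hX₁.mem_over φ hmem)).fmlRel_replace hsub t).inst
          (Tm.replace_self _ t).symm, by simp⟩
      · exact ⟨ψ.2, (hX₁.mem_over ψ hψ).fmlRel_replace hsub t, by simp [hψ]⟩

theorem OverList.exists_fresh (hX₁ : OverList S₁ U₁ X₁) (hX₂ : OverList S₂ U₂ X₂) :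
    ∃ a : ℕ, Sum.inl a ∉ S₁.syms ∧ Sum.inl a ∉ S₂.syms ∧ freeVar a ∉ U₁ ∧ freeVar a ∉ U₂ := by
  have hinj : Function.Injective (freeVar : ℕ → Tm L 0) := fun a b h => by
    simpa [freeVar] using h
  obtain ⟨a, ha⟩ := ((hX₁.finite_vars.union hX₂.finite_vars).union
    ((hX₁.finite.preimage hinj.injOn).union (hX₂.finite.preimage hinj.injOn))).exists_notMem
  simp only [Set.mem_union, not_or] at ha
  exact ⟨a, ha.1.1, ha.1.2, ha.2.1, ha.2.2⟩

theorem cons_subset_cons_append {φ : SFml L} (h : X ⊆ X₁ ++ X₂) :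
    φ :: X ⊆ (φ :: X₁) ++ X₂ :=
  List.cons_subset_cons _ h

theorem cons_subset_append_cons {φ : SFml L} (h : X ⊆ X₁ ++ X₂) :
    φ :: X ⊆ X₁ ++ (φ :: X₂) :=
  List.cons_subset.2 ⟨by simp, fun ψ hψ => by
    have := h hψ
    simp only [List.mem_append, List.mem_cons] at this ⊢
    tauto⟩

/-- Partition and parameter sets vary in the induction, but the signatures do not. The halves need
only cover the list, so they may overlap. -/
theorem Tab.hasInterpolant (h : Tab X) (hX : X ⊆ X₁ ++ X₂) (hX₁ : OverList S₁ U₁ X₁)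
    (hX₂ : OverList S₂ U₂ X₂) : HasInterpolant S₁ S₂ U₁ U₂ X₁ X₂ := by
  induction h generalizing X₁ X₂ U₁ U₂ with
  | ax A h h' =>
    rcases List.mem_append.1 (hX h) with h | h <;> rcases List.mem_append.1 (hX h') with h' | h'
    · exact .of_tab (.ax A h h')
    · exact .ax hX₁ hX₂ h h'
    · exact (HasInterpolant.ax hX₂ hX₁ h h').symm
    · exact (HasInterpolant.of_tab (.ax A h h')).symm
  | top h =>
    rcases List.mem_append.1 (hX h) with h | h
    · exact .of_tab (.top h)
    · exact (HasInterpolant.of_tab (.top h)).symm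
  | bot h =>
    rcases List.mem_append.1 (hX h) with h | h
    · exact .of_tab (.bot h)
    · exact (HasInterpolant.of_tab (.bot h)).symm
  | alpha hφ h _ ih =>
    rcases List.mem_append.1 (hX h) with h | h
    · have ho := hφ.over (hX₁.mem_over _ h)
      exact .alpha hφ h (ih (cons_subset_cons_append (cons_subset_cons_append hX))
        ((hX₁.cons ho.2).cons ho.1) hX₂)
    · have ho := hφ.over (hX₂.mem_over _ h)
      exact (HasInterpolant.alpha hφ h (ih (cons_subset_append_cons (cons_subset_append_cons hX))
        hX₁ ((hX₂.cons ho.2).cons ho.1)).symm).symm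
  | beta hφ h _ _ ih₁ ih₂ =>
    rcases List.mem_append.1 (hX h) with h | h
    · have ho := hφ.over (hX₁.mem_over _ h)
      exact .beta hφ h (ih₁ (cons_subset_cons_append hX) (hX₁.cons ho.1) hX₂)
        (ih₂ (cons_subset_cons_append hX) (hX₁.cons ho.2) hX₂)
    · have ho := hφ.over (hX₂.mem_over _ h)
      exact (HasInterpolant.beta hφ h
        (ih₁ (cons_subset_append_cons hX) hX₁ (hX₂.cons ho.1)).symm
        (ih₂ (cons_subset_append_cons hX) hX₁ (hX₂.cons ho.2)).symm).symm
  | gamma t hφ h _ ih =>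
    rcases List.mem_append.1 (hX h) with h | h
    · exact .gamma hX₁ hX₂ hφ h (ih (cons_subset_cons_append hX)
        (hX₁.cons_inst (hφ.over.1 (hX₁.mem_over _ h)) _ t) hX₂)
    · exact (HasInterpolant.gamma hX₂ hX₁ hφ h (ih (cons_subset_append_cons hX) hX₁
        (hX₂.cons_inst (hφ.over.1 (hX₂.mem_over _ h)) _ t)).symm).symm
  | delta hφ h _ ih =>
    obtain ⟨a, ha₁, ha₂, haU₁, haU₂⟩ := hX₁.exists_fresh hX₂
    rcases List.mem_append.1 (hX h) with h | h
    · exact .delta hX₁ hX₂ hφ h ha₁ ha₂ haU₁ haU₂ (ih _ (cons_subset_cons_append hX)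
        (hX₁.cons_inst (hφ.over.1 (hX₁.mem_over _ h)) _ _) hX₂)
    · exact (HasInterpolant.delta hX₂ hX₁ hφ h ha₂ ha₁ haU₂ haU₁
        (ih _ (cons_subset_append_cons hX) hX₁
          (hX₂.cons_inst (hφ.over.1 (hX₂.mem_over _ h)) _ _)).symm).symm

/-- The signature of a formula. -/
def Fml.sig (A : Formula L) : Sig L :=
  ⟨A.relations, Sum.inl '' A.freeVars ∪ Sum.inr '' A.functions⟩

theorem overList_sig (i : Side) (A : Formula L) : OverList A.sig ∅ [(i, A)] where
  finite_vars := A.finite_freeVars.subset fun a ha => by simpa [Fml.sig] using ha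
  finite := Set.finite_empty
  subtermClosed := fun _ h => h.elim
  mem_over := by
    rintro φ hφ
    cases List.mem_singleton.1 hφ
    exact FmlRel.self (S := A.sig) subset_rfl (fun a ha => Or.inl ⟨a, ha, rfl⟩)
      (fun f hf => Or.inr ⟨f, hf, rfl⟩) _

theorem exists_interpolant {A B : Formula L} (h : Provable {A} {B}) :
    ∃ I : Formula L, InCommonLanguage I A B ∧ Provable {A} {I} ∧ Provable {I} {B} := by
  have hX : Tab [(.first, A), (.second, B)] := h.tab_of_subset (by simp) (by simp)
  obtain ⟨U, I, hI, hU, hU', h₁, h₂⟩ :=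
    hX.hasInterpolant (X₁ := [_]) (X₂ := [_]) (List.Subset.refl _) (overList_sig _ A)
      (overList_sig _ B)
  -- With empty parameter sets an anchored term has its head in both signatures, so it is not alien.
  have hU₀ : U = ∅ := by
    refine Finset.eq_empty_of_forall_notMem fun s hs => ?_
    obtain ⟨d, hd, -, hd₁, hd₂⟩ := hU' s hs
    exact (hU d hd).elim hd₁ hd₂
  subst hU₀
  rw [Finset.coe_empty] at hI
  obtain ⟨hr, hv, hf⟩ := hI.symbols_subset
  refine ⟨I, ⟨hr, fun f h => ?_, fun a h => ?_⟩, h₁.provable ?_, h₂.provable ?_⟩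
  · simpa [Sig.inter, Fml.sig] using hf f h
  · simpa [Sig.inter, Fml.sig] using hv a h
  · simp [sequent]
  · simp [sequent]

end LK

/-! ## Closure under regularity -/

namespace Interp

open StructuredSet

variable {P : Type w} [HasPoints P]

theorem Side.eq_or_eq_opp (i j : Side) : i = j ∨ i = j.opp := by
  cases i <;> cases j <;> simp [Side.opp]

/-- A regular pair constructible from `O`, whose `l`-ary operator acts on the family `S` with the
arguments `s h`, in the components `i h`, and a value in component `i₀`, and whose unary operator
acts on `Sr`. -/
def HasRegularPair (O : Set (Operator P)) {I : Type} (S : I → StructuredSet P) (i₀ : Side)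
    (i : I → Side) (s : I → P) (Sr : StructuredSet P) : Prop :=
  ∃ (k r : Operator P) (x : k.Inst) (y : r.Inst) (e : k.Input ≃ I),
    Constructible O k ∧ Constructible O r ∧ IsRegularPair k r x y ∧
    k.valueSide = i₀ ∧
    (∀ a, k.side a = i (e (k.input a)) ∧ (k.arg x a).src = s (e (k.input a))) ∧
    (∃ S₀, k.Acts x (fun h => S (e h)) S₀) ∧
    (∃ S₀, r.Acts y (fun _ => Sr) S₀)

variable {O : Set (Operator P)} {Sr : StructuredSet P} {i₀ : Side}

theorem HasRegularPair.reindex {I I' : Type} (f : I ≃ I')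
    {S : I' → StructuredSet P} {i : I' → Side} {s : I' → P}
    (h : HasRegularPair O (fun j => S (f j)) i₀ (fun j => i (f j)) (fun j => s (f j)) Sr) :
    HasRegularPair O S i₀ i s Sr := by
  obtain ⟨k, r, x, y, e, h₁, h₂, h₃, h₄, h₅, h₆, h₇⟩ := h
  exact ⟨k, r, x, y, e.trans f, h₁, h₂, h₃, h₄, h₅, h₆, h₇⟩

/-- For a connective whose two-premise and one-premise rules take the same auxiliary formulas on
opposite sides, the two operators share instances, value and embeddings. -/
theorem hasRegularPair_of_ofPair {s₁ s₂ t : Side} {Inst : Type w} {value : Inst → P}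
    {arg₁ arg₂ : (p : Inst) → Link (value p)} {h₁ : ∀ p, (arg₁ p).IsEmbedding}
    {h₂ : ∀ p, (arg₂ p).IsEmbedding}
    (hk : Operator.ofPair s₁ s₂ t Inst value arg₁ arg₂ h₁ h₂ ∈ O)
    (hr : Operator.ofTwo s₁.opp s₂.opp t.opp Inst value arg₁ arg₂ h₁ h₂ ∈ O)
    {S : Bool → StructuredSet P} {i : Bool → Side} {s : Bool → P} (p : Inst)
    (hi₁ : i false = s₁) (hi₂ : i true = s₂)
    (hp₁ : (arg₁ p).src = s false) (hp₂ : (arg₂ p).src = s true)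
    (hs : ∀ b, s b ∈ S b (i b))
    (hSr : single (i false).opp (s false) + single (i true).opp (s true) ≤ Sr) :
    HasRegularPair O S t i s Sr := by
  subst hi₁ hi₂
  refine ⟨_, _, p, p, Equiv.refl Bool, .mem hk, .mem hr,
    ⟨Fintype.card_unit, Function.bijective_id, rfl, Equiv.refl Bool, fun b => ?_, rfl⟩, rfl,
    fun b => ?_, ?_, ?_⟩
  · cases b <;> rfl
  · cases b
    exacts [⟨rfl, hp₁⟩, ⟨rfl, hp₂⟩]
  · obtain ⟨C₁, hC₁⟩ := exists_eq_add_single (hs false)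
    obtain ⟨C₂, hC₂⟩ := exists_eq_add_single (hs true)
    exact ⟨_, Operator.ofPair_acts.2 ⟨C₁, C₂, hp₁ ▸ hC₁, hp₂ ▸ hC₂, rfl⟩⟩
  · obtain ⟨C, hC⟩ := exists_add_of_le hSr
    refine ⟨_, Operator.ofTwo_acts.2 ⟨C, ?_, rfl⟩⟩
    rw [hp₁, hp₂, hC, add_comm]

end Interp

namespace LK

open Interp Interp.StructuredSet

variable {L : FirstOrder.Language.{u, v}} {S₀ Sr : StructuredSet (Formula L)} {i₀ : Side}

/-! ### Changing the component of the value by negation -/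

/-- The operator `k` followed by the rule for negation, which is applied to its value. -/
noncomputable def negComp (k : Operator (Formula L)) : Operator (Formula L) :=
  (negOp k.valueSide).comp k () rfl fun _ => Classical.arbitrary _

/-- The instance `x` of `k`, followed by the negation of its value. -/
noncomputable def negCompInst (k : Operator (Formula L)) (x : k.Inst) : (negComp k).Inst :=
  ⟨(k.value x, x), rfl⟩

instance isEmpty_input_negOp (i : Side) :
    IsEmpty {j : (negOp (L := L) i).Input // j ≠ (negOp (L := L) i).input ()} := ⟨fun j => j.2 rfl⟩

instance isEmpty_arg_negOp (i : Side) :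
    IsEmpty {a : (negOp (L := L) i).Arg // a ≠ ()} := ⟨fun a => a.2 rfl⟩

/-- `negComp k` acts on the same family of structured sets as `k`. -/
def negCompInput (k : Operator (Formula L)) : (negComp k).Input ≃ k.Input :=
  Equiv.emptySum {j : (negOp (L := L) k.valueSide).Input // j ≠ (negOp k.valueSide).input ()} k.Input

/-- `negComp k` takes the same arguments as `k`. -/
def negCompArg (k : Operator (Formula L)) : (negComp k).Arg ≃ k.Arg :=
  Equiv.emptySum {a : (negOp (L := L) k.valueSide).Arg // a ≠ ()} k.Arg

theorem negComp_constructible {k : Operator (Formula L)} (hk : Constructible (operators L) k) :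
    Constructible (operators L) (negComp k) :=
  .comp _ _ _ (.mem (by cases k.valueSide <;> simp [operators])) hk

theorem negComp_argsIn (k : Operator (Formula L)) (x : k.Inst) (j : k.Input) :
    (negComp k).argsIn (negCompInst k x) (Sum.inr j) = k.argsIn x j := by
  unfold Operator.argsIn
  rw [Finset.sum_filter, Finset.sum_filter]
  refine Fintype.sum_equiv (negCompArg k) _ _ ?_
  rintro (a | b)
  · exact (a.2 rfl).elim
  · by_cases h : k.input b = j
    · exact (if_pos (congrArg Sum.inr h)).trans (if_pos h).symm
    · exact (if_neg fun e => h (Sum.inr_injective e)).trans (if_neg h).symm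

theorem negComp_acts {k : Operator (Formula L)} {x : k.Inst}
    {S : k.Input → StructuredSet (Formula L)}
    (h : k.Acts x S S₀) :
    ∃ S₁, (negComp k).Acts (negCompInst k x) (fun j => S (negCompInput k j)) S₁ := by
  classical
  obtain ⟨C, hC, hS, -⟩ := h
  refine ⟨_, fun j => C (negCompInput k j), ⟨?_, trivial⟩, ?_, rfl⟩
  · refine (iff_of_eq (congrArg (k.Applicable x) (funext fun j => ?_))).2 hC
    refine (congrArg (C j + ·) (Finset.sum_eq_zero fun a ha => ?_)).trans (add_zero _)
    exact absurd rfl (Finset.mem_filter.1 ha).2.1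
  · rintro (j | j)
    · exact (j.2 rfl).elim
    · exact (hS j).trans (congrArg (C j + ·) (negComp_argsIn k x j).symm)

/-- The arguments of a pattern, linked to the negation of its value. -/
def negPattern {I J : Type} [IsEmpty J] (q : Σ s : Formula L, (I → Link s)) :
    Σ s : Formula L, (J ⊕ I → Link s) :=
  ⟨.neg q.1, Sum.rec (fun a => isEmptyElim a)
    fun b => (q.2 b).comp (linkOf (B := .neg q.1) q.1 fun x => x) rfl⟩

theorem negComp_isRegularPair {k r : Operator (Formula L)} {x : k.Inst} {y : r.Inst}
    (h : IsRegularPair k r x y) :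
    IsRegularPair (negComp k) (negComp r) (negCompInst k x) (negCompInst r y) := by
  obtain ⟨h₁, h₂, h₃, e, h₄, h₅⟩ := h
  refine ⟨(Fintype.card_congr (negCompInput r)).trans h₁, ⟨?_, (negComp k).input_surjective⟩,
    congrArg Side.opp h₃,
    Equiv.sumCongr (Equiv.equivOfIsEmpty {a : (negOp (L := L) k.valueSide).Arg // a ≠ ()}
      {a : (negOp (L := L) r.valueSide).Arg // a ≠ ()}) e, ?_, ?_⟩
  · rintro (a | a) (b | b) hab
    · exact (a.2 rfl).elim
    · exact (a.2 rfl).elim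
    · exact (b.2 rfl).elim
    · exact congrArg Sum.inr (h₂.1 (Sum.inr_injective hab))
  · rintro (a | a)
    · exact (a.2 rfl).elim
    · exact h₄ a
  · have key := congrArg
      (negPattern (J := {a : (negOp (L := L) k.valueSide).Arg // a ≠ ()})) h₅
    refine Eq.trans ?_ (key.trans ?_)
    · refine Sigma.ext rfl (heq_of_eq (funext ?_))
      rintro (a | a)
      · exact (a.2 rfl).elim
      · rfl
    · refine Sigma.ext rfl (heq_of_eq (funext ?_))
      rintro (a | a)
      · exact (a.2 rfl).elim
      · rfl

/-- Applying the rule for negation to both values keeps them equal, sends each to the opposite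
component and leaves the arguments untouched. -/
theorem HasRegularPair.neg {I : Type} {S : I → StructuredSet (Formula L)} {i : I → Side}
    {s : I → Formula L} (h : HasRegularPair (operators L) S i₀ i s Sr) :
    HasRegularPair (operators L) S i₀.opp i s Sr := by
  obtain ⟨k, r, x, y, e, hk, hr, hkr, hv, ha, ⟨S₁, h₁⟩, S₂, h₂⟩ := h
  refine ⟨negComp k, negComp r, negCompInst k x, negCompInst r y, (negCompInput k).trans e,
    negComp_constructible hk, negComp_constructible hr, negComp_isRegularPair hkr,
    congrArg Side.opp hv, ?_, negComp_acts h₁, negComp_acts h₂⟩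
  rintro (a | a)
  · exact (a.2 rfl).elim
  · exact ha a

theorem HasRegularPair.of_valueSide {I : Type} {S : I → StructuredSet (Formula L)} {i : I → Side}
    {s : I → Formula L} {j : Side} (h : HasRegularPair (operators L) S j i s Sr) (i₀ : Side) :
    HasRegularPair (operators L) S i₀ i s Sr := by
  rcases Side.eq_or_eq_opp i₀ j with rfl | rfl
  exacts [h, HasRegularPair.neg h]

/-- The two rules for negation are a regular pair whose unary operators start from opposite
components; a second negation adjusts the component of the value if necessary. -/
theorem hasRegularPair_unit {S : Unit → StructuredSet (Formula L)} {i : Unit → Side}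
    {s : Unit → Formula L} (hs : ∀ h, s h ∈ S h (i h))
    (hSr : ∑ h, StructuredSet.single (i h).opp (s h) ≤ Sr) :
    HasRegularPair (operators L) S i₀ i s Sr := by
  refine HasRegularPair.of_valueSide (j := (i ()).opp) ?_ i₀
  refine ⟨negOp (i ()), negOp (i ()).opp, s (), s (), Equiv.refl Unit,
    .mem (by cases i () <;> simp [operators]),
    .mem (by cases i () <;> simp [operators, Side.opp]),
    ⟨Fintype.card_unit, Function.bijective_id, rfl, Equiv.refl Unit, fun _ => rfl, rfl⟩, rfl,
    fun _ => ⟨rfl, rfl⟩, ?_, ?_⟩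
  · obtain ⟨C, hC⟩ := exists_eq_add_single (hs ())
    exact ⟨_, Operator.ofOne_acts.2 ⟨C, trivial, hC, rfl⟩⟩
  · obtain ⟨C, hC⟩ := exists_add_of_le hSr
    refine ⟨_, Operator.ofOne_acts.2 ⟨C, trivial, ?_, rfl⟩⟩
    rw [hC, add_comm, Fintype.sum_unique]
    rfl

/-- The connective is dictated by the components of the arguments: ∨ for two antecedents, ∧ for two
succedents, ⊃ for one of each. -/
theorem hasRegularPair_bool {S : Bool → StructuredSet (Formula L)} {i : Bool → Side}
    {s : Bool → Formula L} (hs : ∀ h, s h ∈ S h (i h))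
    (hSr : ∑ h, StructuredSet.single (i h).opp (s h) ≤ Sr) :
    HasRegularPair (operators L) S i₀ i s Sr := by
  rw [Fintype.sum_bool, add_comm] at hSr
  have and_left : andLOp ∈ operators L := by simp [operators]
  have and_right : andROp ∈ operators L := by simp [operators]
  have or_left : orLOp ∈ operators L := by simp [operators]
  have or_right : orROp ∈ operators L := by simp [operators]
  have imp_left : impLOp ∈ operators L := by simp [operators]
  have imp_right : impROp ∈ operators L := by simp [operators]
  rcases h₁ : i false <;> rcases h₂ : i true
  · exact HasRegularPair.of_valueSide (hasRegularPair_of_ofPair or_left or_right (s false, s true)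
      h₁ h₂ rfl rfl hs hSr) i₀
  -- The rule ⊃:left expects its succedent argument first, so the two structured sets are
  -- interchanged.
  · refine HasRegularPair.of_valueSide (HasRegularPair.reindex Equiv.boolNot
      (hasRegularPair_of_ofPair imp_left imp_right (s true, s false)
        h₂ h₁ rfl rfl (fun b => hs _) ?_)) i₀
    rw [add_comm]
    exact hSr
  · exact HasRegularPair.of_valueSide (hasRegularPair_of_ofPair imp_left imp_right
      (s false, s true) h₁ h₂ rfl rfl hs hSr) i₀
  · exact HasRegularPair.of_valueSide (hasRegularPair_of_ofPair and_right and_left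
      (s false, s true) h₁ h₂ rfl rfl hs hSr) i₀

theorem operators_closedUnderRegularity : ClosedUnderRegularity (operators L) := by
  intro o ho S _ i₀ i s hs Sr hSr
  rcases ho with rfl | rfl | rfl | rfl | rfl | rfl | rfl | rfl | rfl | rfl | rfl | rfl | rfl | rfl
  -- Only the arity of the given operator matters: it acts on a family indexed by `Unit` or by
  -- `Bool`.
  all_goals first | exact hasRegularPair_unit hs hSr | exact hasRegularPair_bool hs hSr

end LK

theorem mainTheorem4 (L : FirstOrder.Language.{u, v}) :
    (∀ Γ Δ : Multiset (LK.Formula L),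
      LK.Provable Γ Δ ↔
        Interp.Generated (LK.operators L) (LK.initial L) (LK.sequent Γ Δ)) ∧
    Interp.ClosedUnderRegularity (LK.operators L) ∧
    (∀ A B : LK.Formula L, LK.Provable {A} {B} →
      ∃ I : LK.Formula L, LK.InCommonLanguage I A B ∧ LK.Provable {A} {I} ∧ LK.Provable {I} {B}) := by
  exact ⟨LK.provable_iff_generated, LK.operators_closedUnderRegularity,
    fun _ _ h => LK.exists_interpolant h⟩
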